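/- **Setting.** Let $\mathfrak g$ be a finite-dimensional complex simple Lie algebra with Killing form $B$, and let $\rho^{(1)},\rho^{(2)}:\mathfrak g\to \mathrm{End}(\mathbb C^{d})$ be faithful representations. For a basis $(X_A)$ of $\mathfrak g$ let $B^{AB}$ be the inverse of the matrix $B_{AB}=B(X_A,X_B)$, and put $C^{(ij)}=\sum_{A,B} B^{AB}\rho^{(i)}(X_A)\otimes\rho^{(j)}(X_B)$. Let $R^{(ij)}(u)\in \mathrm{End}(\mathbb C^d\otimes\mathbb C^d)$, $i,j\in\{1,2\}$, be quasi-classical R-matrices: they satisfy the Yang–Baxter equations $$R^{(ij)}_{12}(u)R^{(ik)}_{13}(u+v)R^{(jk)}_{23}(v)=R^{(jk)}_{23}(v)R^{(ik)}_{13}(u+v)R^{(ij)}_{12}(u)\qquad (i,j,k\in\{1,2\})$$ and $R^{(ij)}(u)=1+\frac1u C^{(ij)}+\mathcal O(u^{-2})$ as $u\to\infty$ in $\mathbb C$. Let $d_B\ge 1$ and let $K(u)\in \mathrm{End}(\mathbb C^d\otimes\mathbb C^{d_B})$ be a K-matrix in the representation $(\rho^{(1)},\rho^{(2)})$, i.e.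 it satisfies the boundary Yang–Baxter equation $$R^{(11)}_{12}(u-v)K_{13}(u)R^{(12)}_{21}(u+v)K_{23}(v)=K_{23}(v)R^{(12)}_{12}(u+v)K_{13}(u)R^{(22)}_{21}(u-v),$$ where $R_{21}=PR_{12}P$ with $P$ the flip of the first two factors, and for some subalgebra $\mathfrak h_0\subseteq\mathfrak g$ (possibly $0$) and some representation $\rho'$ of $\mathfrak h_0$ on $\mathbb C^{d_B}$, $$(\rho^{(1)}(X)\otimes 1)K(u)-K(u)(\rho^{(2)}(X)\otimes 1)+[1\otimes\rho'(X),K(u)]=0\qquad (X\in\mathfrak h_0).$$ The functions $R^{(ij)}$ and $K$ may have poles in a bounded subset of $\mathbb C$; all equations are required where their arguments are regular. Suppose that $K$ has an expansion $K(u)=\tilde\kappa+\frac1u k^{(1)}+\mathcal O(u^{-2})$ as $u\to\infty$, that $K$ is quasi-classical ($\tilde\kappa$ is invertible), and that $K$ is irreducible: writing $K(u)=\sum_{i,j}E_{ij}\otimes\Psi^{ij}(u)$ with the elementary matrices $E_{ij}$ of $\mathrm{End}(\mathbb C^d)$, no nonzero proper subspace of $\mathbb C^{d_B}$ is invariant under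 all $\Psi^{ij}(u)$. **Lemma.** Then $\tilde\kappa=\kappa\otimes 1$ for some invertible $\kappa\in \mathrm{End}(\mathbb C^d)$, and there is a unique Lie algebra endomorphism $\alpha$ of $\mathfrak g$ with $\alpha^2=\mathrm{id}$ and $\kappa\rho^{(2)}(X)\kappa^{-1}=\rho^{(1)}(\alpha(X))$ for all $X\in\mathfrak g$. Let $\mathfrak h=\{X\in\mathfrak g:\alpha(X)=X\}$, let $(X_a)$ be a basis of $\mathfrak h$ and $B^{ab}$ the inverse of the matrix $B(X_a,X_b)$, where $B$ is still the Killing form of $\mathfrak g$, and put $c^{(\mathfrak h,1)}=\sum_{a,b}B^{ab}\rho^{(1)}(X_a)\rho^{(1)}(X_b)$. Then there are $D\in \mathrm{End}(\mathbb C^d)$ with $[D,\rho^{(1)}(X)]=0$ for all $X\in\mathfrak g$ and a representation $\rho^{(B)}:\mathfrak h\to \mathrm{End}(\mathbb C^{d_B})$ such that, with $C^{(\mathfrak h,1B)}=\sum_{a,b}B^{ab}\rho^{(1)}(X_a)\otimes\rho^{(B)}(X_b)$, $$K(u)=\kappa\otimes 1+\frac1u\Big(\tfrac12 c^{(\mathfrak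 h,1)}\otimes 1+D\otimes 1+2C^{(\mathfrak h,1B)}\Big)(\kappa\otimes 1)+\mathcal O(u^{-2})\qquad(u\to\infty).$$ -/

import Mathlib

open scoped Kronecker Matrix

attribute [local instance 100] LieRing.ofAssociativeRing

noncomputable section

namespace KMat

/-- `M u = O(u⁻ⁿ)`, entry by entry, as `u → ∞` in the complex plane. -/
def IsBigOInv {p q : Type*} (M : ℂ → Matrix p q ℂ) (n : ℕ) : Prop :=
  ∀ i j, (fun u => M u i j) =O[Bornology.cobounded ℂ] fun u => (u ^ n)⁻¹

section Legs

variable {l m n : Type*} [DecidableEq l] [DecidableEq m] [DecidableEq n]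

/-- `A₁₂`: the operator `A` on the tensor factors 1 and 2 of a triple tensor product. -/
def leg12 (A : Matrix (l × m) (l × m) ℂ) : Matrix (l × m × n) (l × m × n) ℂ :=
  Matrix.of fun p q => if p.2.2 = q.2.2 then A (p.1, p.2.1) (q.1, q.2.1) else 0

/-- `A₁₃`: the operator `A` on the tensor factors 1 and 3 of a triple tensor product. -/
def leg13 (A : Matrix (l × n) (l × n) ℂ) : Matrix (l × m × n) (l × m × n) ℂ :=
  Matrix.of fun p q => if p.2.1 = q.2.1 then A (p.1, p.2.2) (q.1, q.2.2) else 0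

/-- `A₂₃`: the operator `A` on the tensor factors 2 and 3 of a triple tensor product. -/
def leg23 (A : Matrix (m × n) (m × n) ℂ) : Matrix (l × m × n) (l × m × n) ℂ :=
  Matrix.of fun p q => if p.1 = q.1 then A (p.2.1, p.2.2) (q.2.1, q.2.2) else 0

/-- `A₂₁ = P A P`, with `P` the flip of the two tensor factors. -/
def flip21 (A : Matrix (l × m) (l × m) ℂ) : Matrix (m × l) (m × l) ℂ :=
  A.submatrix Prod.swap Prod.swap

end Legs

section Casimir

variable {V : Type*} [AddCommGroup V] [Module ℂ V]

/-- Independence of the basis, for any bilinear expression `F` in two basis vectors. -/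
theorem sum_inv_gram_eq {ι κ W : Type*} [Fintype ι] [Fintype κ] [DecidableEq ι] [DecidableEq κ]
    [AddCommGroup W] [Module ℂ W] (B : LinearMap.BilinForm ℂ V) (F : V →ₗ[ℂ] V →ₗ[ℂ] W)
    (X : Module.Basis ι ℂ V) (Y : Module.Basis κ ℂ V) :
    ∑ a, ∑ b, (LinearMap.BilinForm.toMatrix X B)⁻¹ a b • F (X a) (X b) =
      ∑ a, ∑ b, (LinearMap.BilinForm.toMatrix Y B)⁻¹ a b • F (Y a) (Y b) := by
  have hPQ : Y.toMatrix X * X.toMatrix Y = 1 := Y.toMatrix_mul_toMatrix_flip X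
  have hQP : X.toMatrix Y * Y.toMatrix X = 1 := X.toMatrix_mul_toMatrix_flip Y
  have hX : (Y.toMatrix X)ᵀ * LinearMap.BilinForm.toMatrix Y B * Y.toMatrix X =
      LinearMap.BilinForm.toMatrix X B := LinearMap.BilinForm.toMatrix_mul_basis_toMatrix Y X B
  have hY : (X.toMatrix Y)ᵀ * LinearMap.BilinForm.toMatrix X B * X.toMatrix Y =
      LinearMap.BilinForm.toMatrix Y B := LinearMap.BilinForm.toMatrix_mul_basis_toMatrix X Y B
  have key : (LinearMap.BilinForm.toMatrix Y B)⁻¹ =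
      Y.toMatrix X * (LinearMap.BilinForm.toMatrix X B)⁻¹ * (Y.toMatrix X)ᵀ := by
    generalize LinearMap.BilinForm.toMatrix X B = G at *
    generalize LinearMap.BilinForm.toMatrix Y B = H at *
    generalize Y.toMatrix X = Q at *
    generalize X.toMatrix Y = P at *
    by_cases hG : IsUnit G.det
    · apply Matrix.inv_eq_right_inv
      calc H * (Q * G⁻¹ * Qᵀ) = Pᵀ * G * (P * Q) * G⁻¹ * Qᵀ := by
            rw [← hY]; simp only [Matrix.mul_assoc]
        _ = (Q * P)ᵀ := by
            rw [hQP, Matrix.mul_one, Matrix.mul_nonsing_inv_cancel_right _ _ hG,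
              Matrix.transpose_mul]
        _ = 1 := by rw [hPQ, Matrix.transpose_one]
    · have hH : ¬ IsUnit H.det := by
        intro hH
        apply hG
        apply Matrix.isUnit_det_of_right_inverse (B := P * H⁻¹ * Pᵀ)
        calc G * (P * H⁻¹ * Pᵀ) = Qᵀ * H * (Q * P) * H⁻¹ * Pᵀ := by
              rw [← hX]; simp only [Matrix.mul_assoc]
          _ = (P * Q)ᵀ := by
              rw [hPQ, Matrix.mul_one, Matrix.mul_nonsing_inv_cancel_right _ _ hH,
                Matrix.transpose_mul]
          _ = 1 := by rw [hQP, Matrix.transpose_one]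
      rw [Matrix.nonsing_inv_apply_not_isUnit _ hG, Matrix.nonsing_inv_apply_not_isUnit _ hH]
      simp
  have hexp : ∀ a, X a = ∑ i, Y.toMatrix X i a • Y i := fun a =>
    (Y.sum_toMatrix_smul_self X a).symm
  rw [key]
  generalize (LinearMap.BilinForm.toMatrix X B)⁻¹ = G
  generalize Y.toMatrix X = Q at *
  simp only [hexp, map_sum, map_smul, LinearMap.sum_apply, LinearMap.smul_apply, Finset.smul_sum,
    Matrix.mul_apply, Matrix.transpose_apply, Finset.sum_mul, Finset.sum_smul, smul_smul]
  calc _ = ∑ p : ι × ι × κ × κ,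
        (G p.1 p.2.1 * (Q p.2.2.1 p.1 * Q p.2.2.2 p.2.1)) • F (Y p.2.2.1) (Y p.2.2.2) := by
        simp only [Fintype.sum_prod_type]
        refine Finset.sum_congr rfl fun a _ => Finset.sum_congr rfl fun b _ => ?_
        rw [Finset.sum_comm]
        refine Finset.sum_congr rfl fun i _ => Finset.sum_congr rfl fun j _ => ?_
        congr 1; ring
    _ = ∑ p : κ × κ × ι × ι,
        (G p.2.2.2 p.2.2.1 * (Q p.1 p.2.2.2 * Q p.2.1 p.2.2.1)) • F (Y p.1) (Y p.2.1) := by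
        refine Fintype.sum_equiv ⟨fun p => (p.2.2.1, p.2.2.2, p.2.1, p.1),
          fun p => (p.2.2.2, p.2.2.1, p.1, p.2.1), fun _ => rfl, fun _ => rfl⟩ _ _ fun _ => rfl
    _ = _ := by
        simp only [Fintype.sum_prod_type]
        refine Finset.sum_congr rfl fun i _ => Finset.sum_congr rfl fun j _ =>
          Finset.sum_congr rfl fun b _ => Finset.sum_congr rfl fun a _ => ?_
        congr 1; ring

variable [FiniteDimensional ℂ V] {m n : Type*}

/-- `∑ B^{ab} φ(X_a) ⊗ ψ(X_b)`, where `(X_a)` is a basis of `V` and `B^{ab}` is the inverse of the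
matrix `B_{ab} = B(X_a, X_b)`. It does not depend on the basis, see `casimirTensor_eq`. -/
def casimirTensor (B : LinearMap.BilinForm ℂ V)
    (φ : V →ₗ[ℂ] Matrix m m ℂ) (ψ : V →ₗ[ℂ] Matrix n n ℂ) : Matrix (m × n) (m × n) ℂ :=
  let X := Module.finBasis ℂ V
  ∑ a, ∑ b, (LinearMap.BilinForm.toMatrix X B)⁻¹ a b • (φ (X a) ⊗ₖ ψ (X b))

/-- `∑ B^{ab} φ(X_a) φ(X_b)`, with the same notation. -/
def casimir [Fintype m] (B : LinearMap.BilinForm ℂ V) (φ : V →ₗ[ℂ] Matrix m m ℂ) :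
    Matrix m m ℂ :=
  let X := Module.finBasis ℂ V
  ∑ a, ∑ b, (LinearMap.BilinForm.toMatrix X B)⁻¹ a b • (φ (X a) * φ (X b))

theorem casimirTensor_eq {ι : Type*} [Fintype ι] [DecidableEq ι] (B : LinearMap.BilinForm ℂ V)
    (φ : V →ₗ[ℂ] Matrix m m ℂ) (ψ : V →ₗ[ℂ] Matrix n n ℂ) (X : Module.Basis ι ℂ V) :
    casimirTensor B φ ψ =
      ∑ a, ∑ b, (LinearMap.BilinForm.toMatrix X B)⁻¹ a b • (φ (X a) ⊗ₖ ψ (X b)) :=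
  sum_inv_gram_eq B (LinearMap.mk₂ ℂ (fun x y => φ x ⊗ₖ ψ y)
    (by intros; simp [Matrix.add_kronecker]) (by intros; simp [Matrix.smul_kronecker])
    (by intros; simp [Matrix.kronecker_add]) (by intros; simp [Matrix.kronecker_smul]))
    (Module.finBasis ℂ V) X

theorem casimir_eq {ι : Type*} [Fintype ι] [DecidableEq ι] [Fintype m] [DecidableEq m]
    (B : LinearMap.BilinForm ℂ V) (φ : V →ₗ[ℂ] Matrix m m ℂ) (X : Module.Basis ι ℂ V) :
    casimir B φ =
      ∑ a, ∑ b, (LinearMap.BilinForm.toMatrix X B)⁻¹ a b • (φ (X a) * φ (X b)) :=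
  sum_inv_gram_eq B ((LinearMap.mul ℂ (Matrix m m ℂ)).compl₁₂ φ φ) (Module.finBasis ℂ V) X

end Casimir

section Lie

variable {𝔤 : Type*} [LieRing 𝔤] [LieAlgebra ℂ 𝔤] [FiniteDimensional ℂ 𝔤]

/-- The invariant subalgebra of an endomorphism of a Lie algebra. -/
def fixedSubalgebra (α : 𝔤 →ₗ⁅ℂ⁆ 𝔤) : LieSubalgebra ℂ 𝔤 where
  carrier := {X | α X = X}
  add_mem' := by intro X Y hX hY; simp_all
  zero_mem' := by simp
  smul_mem' := by intro c X hX; simp_all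
  lie_mem' := by intro X Y hX hY; simp_all

/-- The Killing form of `𝔤`, restricted to a subalgebra. -/
def killingOn (𝔥 : LieSubalgebra ℂ 𝔤) : LinearMap.BilinForm ℂ 𝔥 :=
  (killingForm ℂ 𝔤).restrict 𝔥.toSubmodule

/-- A family of quasi-classical R-matrices `R i j` in the representations `ρ i ⊗ ρ j`.
`S` is the set of regular points: the R-matrices may have poles (or be undefined) in the bounded
set `Sᶜ`, and the Yang-Baxter equation is imposed where all its arguments are regular. -/
structure IsQuasiClassicalR {ι : Type*} {d : ℕ} (ρ : ι → 𝔤 →ₗ⁅ℂ⁆ Matrix (Fin d) (Fin d) ℂ)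
    (S : Set ℂ) (R : ι → ι → ℂ → Matrix (Fin d × Fin d) (Fin d × Fin d) ℂ) : Prop where
  regular : S ∈ Bornology.cobounded ℂ
  yangBaxter : ∀ i j k, ∀ u v : ℂ, u ∈ S → v ∈ S → u + v ∈ S →
    (leg12 (R i j u) * leg13 (R i k (u + v)) * leg23 (R j k v) :
        Matrix (Fin d × Fin d × Fin d) (Fin d × Fin d × Fin d) ℂ) =
      leg23 (R j k v) * leg13 (R i k (u + v)) * leg12 (R i j u)
  asymptotics : ∀ i j, IsBigOInv (fun u => R i j u -
    (1 + u⁻¹ • casimirTensor (killingForm ℂ 𝔤) (ρ i : 𝔤 →ₗ[ℂ] Matrix (Fin d) (Fin d) ℂ)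
      (ρ j : 𝔤 →ₗ[ℂ] Matrix (Fin d) (Fin d) ℂ))) 2

/-- `K` is a `(𝔤, 𝔥)` symmetric K-matrix in the representation `(ρ 0, ρ 1)`, with boundary space
`ℂ^dB`. `S` and `T` are the sets of regular points of `R` and of `K`. -/
structure IsKMatrix {d dB : ℕ} (ρ : Fin 2 → 𝔤 →ₗ⁅ℂ⁆ Matrix (Fin d) (Fin d) ℂ)
    (S : Set ℂ) (R : Fin 2 → Fin 2 → ℂ → Matrix (Fin d × Fin d) (Fin d × Fin d) ℂ)
    (𝔥 : LieSubalgebra ℂ 𝔤)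
    (T : Set ℂ) (K : ℂ → Matrix (Fin d × Fin dB) (Fin d × Fin dB) ℂ) : Prop where
  regular : T ∈ Bornology.cobounded ℂ
  symmetric : ∃ ρB : 𝔥 →ₗ⁅ℂ⁆ Matrix (Fin dB) (Fin dB) ℂ, ∀ u ∈ T, ∀ X : 𝔥,
    (ρ 0 X ⊗ₖ 1) * K u - K u * (ρ 1 X ⊗ₖ 1) + ((1 ⊗ₖ ρB X) * K u - K u * (1 ⊗ₖ ρB X)) = 0
  boundaryYangBaxter : ∀ u ∈ T, ∀ v ∈ T, u - v ∈ S → u + v ∈ S →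
    leg12 (R 0 0 (u - v)) * leg13 (K u) * leg12 (flip21 (R 0 1 (u + v))) * leg23 (K v) =
      leg23 (K v) * leg12 (R 0 1 (u + v)) * leg13 (K u) * leg12 (flip21 (R 1 1 (u - v)))

/-- `K` is quasi-classical with leading coefficient `κ'`. -/
structure IsQuasiClassicalK {p : Type*} [Fintype p] [DecidableEq p]
    (K : ℂ → Matrix p p ℂ) (κ' : Matrix p p ℂ) : Prop where
  asymptotics : IsBigOInv (fun u => K u - κ') 1
  isUnit : IsUnit κ'

/-- The block `Ψ^{ij}` in `K = ∑ E_{ij} ⊗ Ψ^{ij}`. -/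
def block {d dB : ℕ} (K : Matrix (Fin d × Fin dB) (Fin d × Fin dB) ℂ) (i j : Fin d) :
    Matrix (Fin dB) (Fin dB) ℂ :=
  Matrix.of fun b c => K (i, b) (j, c)

/-- No nonzero proper subspace of the (nonzero) boundary space is invariant under all `Ψ^{ij}(u)`,
for all `i`, `j` and all regular points `u`. -/
def IsIrreducibleK {d dB : ℕ} (T : Set ℂ)
    (K : ℂ → Matrix (Fin d × Fin dB) (Fin d × Fin dB) ℂ) : Prop :=
  0 < dB ∧ ∀ W : Submodule ℂ (Fin dB → ℂ),
    (∀ u ∈ T, ∀ i j, ∀ w ∈ W, block (K u) i j *ᵥ w ∈ W) → W = ⊥ ∨ W = ⊤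

/-- `α` is an involution with `Ad_κ (ρ 1 X) = ρ 0 (α X)`. -/
def IsAssociatedInvolution {d : ℕ} (ρ : Fin 2 → 𝔤 →ₗ⁅ℂ⁆ Matrix (Fin d) (Fin d) ℂ)
    (κ : Matrix (Fin d) (Fin d) ℂ) (α : 𝔤 →ₗ⁅ℂ⁆ 𝔤) : Prop :=
  (∀ X, α (α X) = X) ∧ ∀ X, κ * ρ 1 X * κ⁻¹ = ρ 0 (α X)

end Lie

end KMat

end

set_option linter.unusedSectionVars false

noncomputable section

/-! Everything comes from the boundary Yang–Baxter equation at large spectral parameters, in two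
regimes. Write k₁ for the 1/u coefficient of K and σ(X) = κ ρ 1(X) κ⁻¹.

Regime one: u → ∞ with v fixed. At order 1 the leading coefficient of K, in legs 1 and 3, commutes
with K₂₃(v). Schur's lemma for irreducible K turns its blocks into scalars, so it is κ ⊗ 1. At order
1/u, with orthonormal X_a, Σ (ρ 0 + σ)(X_a)₁ (ρ 0(X_a) K(v) − K(v) ρ 1(X_a))₂₃ + [(k₁κ⁻¹)₁₃, K₂₃(v)]
= 0 (`IsKMatrix.classical_equation`). Letting v → ∞ as well leaves Σ (ρ 0 + σ)(X_a) ⊗ (ρ 0 − σ)(X_a)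
= 0. Hence the orthogonal complement of ker(ρ 0 − σ) lies in ker(ρ 0 + σ). Faithfulness makes these
kernels meet in 0, so 𝔤 is their sum, and α is +1 on the first and −1 on the second.

Consequently only 𝔥 contributes to the first leg of the 1/u equation. Functionals dual to ρ 0(X_a)
contract the blocks of k₁κ⁻¹ to boundary operators that make K symmetric under 𝔥. By Schur, their
failure to represent 𝔥 is scalar, and a trace normalisation removes it. A further use of Schur gives
k₁κ⁻¹ = E ⊗ 1 + 2 Σ ρ 0(X_a) ⊗ ρB(X_a), with E commuting with ρ 0(𝔥).

Regime two: u, v → ∞ together with u + v = c(u − v). The second order terms of the R-matrices are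
unknown, but the remaining ones combine to (2/c) N, where N is a commutator independent of c.
Comparing c = r with c = −r and then taking r → ∞ forces N = 0 (`eq_zero_of_reflection`).

For F = E − ½ c^(𝔥) and X_a running over the −1 eigenspace, N = 0 reads Σ [X_a, F] ⊗ X_a + X_a ⊗
[X_a, F] = 0. So F induces a derivation of 𝔤, which is ad z with z central in 𝔥
(`exists_central_shift`). Then D = F + ρ 0(z) commutes with ρ 0(𝔤). The leftover −ρ 0(z) is absorbed
into ρB by the character −½ B(·, z). -/

namespace KMat

open Asymptotics Filter Bornology Topology

/-! ### Calculus of first and second order asymptotic expansions -/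

section Expansion

variable {α A : Type*} [NormedRing A] [NormedAlgebra ℂ A] {l : Filter α} {s : α → ℂ}

/-- `f = A₀ + s A₁ + O(s²)` along the filter `l`. -/
def HasExpansion (l : Filter α) (s : α → ℂ) (f : α → A) (A₀ A₁ : A) : Prop :=
  (fun t => f t - (A₀ + s t • A₁)) =O[l] fun t => s t ^ 2

/-- `f = 1 + s X + e + O(s³)` along the filter `l`, with `e = O(s²)`. -/
def HasExpansionTwo (l : Filter α) (s : α → ℂ) (f : α → A) (X : A) (e : α → A) : Prop :=
  (fun t => f t - (1 + s t • X + e t)) =O[l] (fun t => s t ^ 3) ∧ e =O[l] fun t => s t ^ 2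

theorem isBigO_pow_of_le (hs : Tendsto s l (𝓝 0)) {m n : ℕ} (h : m ≤ n) :
    (fun t => s t ^ n) =O[l] fun t => s t ^ m := by
  obtain ⟨k, rfl⟩ := Nat.exists_eq_add_of_le h
  have h1 : (fun t => s t ^ k) =O[l] fun _ => (1 : ℂ) := (hs.pow k).isBigO_one ℂ
  simpa [pow_add] using (isBigO_refl (fun t => s t ^ m) l).mul h1

theorem isBigO_smul_const (X : A) : (fun t => s t • X) =O[l] fun t => s t ^ 1 := by
  refine IsBigO.of_bound ‖X‖ (Eventually.of_forall fun t => ?_)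
  rw [norm_smul, pow_one, mul_comm]

theorem isBigO_const_pow_zero (X : A) : (fun _ => X) =O[l] fun t => s t ^ 0 := by
  simpa using isBigO_const_const X (one_ne_zero (α := ℂ)) l

theorem isBigO_mul_pow {f g : α → A} {m n : ℕ} (hf : f =O[l] fun t => s t ^ m)
    (hg : g =O[l] fun t => s t ^ n) : (fun t => f t * g t) =O[l] fun t => s t ^ (m + n) := by
  simpa [pow_add] using hf.mul hg

theorem isBigO_mul_pow' {f g : α → A} {m n k : ℕ} (hs : Tendsto s l (𝓝 0))
    (hf : f =O[l] fun t => s t ^ m)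
    (hg : g =O[l] fun t => s t ^ n) (h : k ≤ m + n := by norm_num) :
    (fun t => f t * g t) =O[l] fun t => s t ^ k :=
  (isBigO_mul_pow hf hg).trans (isBigO_pow_of_le hs h)

theorem HasExpansion.isBigO_one {f : α → A} {A₀ A₁ : A} (hs : Tendsto s l (𝓝 0))
    (hf : HasExpansion l s f A₀ A₁) : f =O[l] fun t => s t ^ 0 := by
  have := ((IsBigO.trans hf (isBigO_pow_of_le hs (Nat.zero_le 2))).add
    (isBigO_const_pow_zero A₀)).add
    ((isBigO_smul_const (s := s) (l := l) A₁).trans (isBigO_pow_of_le hs (Nat.zero_le 1)))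
  refine this.congr_left fun t => ?_
  abel

theorem HasExpansion.const (a : A) : HasExpansion l s (fun _ => a) a 0 := by
  simp [HasExpansion, isBigO_zero]

theorem HasExpansion.mul {f g : α → A} {A₀ A₁ B₀ B₁ : A} (hs : Tendsto s l (𝓝 0))
    (hf : HasExpansion l s f A₀ A₁) (hg : HasExpansion l s g B₀ B₁) :
    HasExpansion l s (fun t => f t * g t) (A₀ * B₀) (A₁ * B₀ + A₀ * B₁) := by
  have h1 := isBigO_mul_pow hf (hg.isBigO_one hs)
  have hF := (HasExpansion.isBigO_one (f := fun t => A₀ + s t • A₁) (A₀ := A₀) (A₁ := A₁) hs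
    (by simp [HasExpansion, isBigO_zero]))
  have h2 := isBigO_mul_pow' (k := 2) hs hF hg
  have h3 := isBigO_mul_pow (isBigO_smul_const (s := s) (l := l) A₁)
    (isBigO_smul_const (s := s) (l := l) B₁)
  refine ((h1.add h2).add h3).congr_left fun t => ?_
  simp only [mul_add, add_mul, mul_sub, sub_mul, smul_add, smul_mul_assoc, mul_smul_comm]
  abel

theorem HasExpansion.unique [l.NeBot] {f : α → A} {A₀ A₁ B₀ B₁ : A} (hs : Tendsto s l (𝓝[≠] 0))
    (hf : HasExpansion l s f A₀ A₁) (hg : HasExpansion l s f B₀ B₁) : A₀ = B₀ ∧ A₁ = B₁ := by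
  have hs0 : Tendsto s l (𝓝 0) := tendsto_nhds_of_tendsto_nhdsWithin hs
  have hne : ∀ᶠ t in l, s t ≠ 0 := hs.eventually self_mem_nhdsWithin
  have h := IsBigO.sub hf hg
  have aux : ∀ {f : α → A} {a : A}, Tendsto f l (𝓝 a) → f =O[l] s → a = 0 := fun hf hO =>
    tendsto_nhds_unique hf (hO.trans_tendsto hs0)
  have hsm : ∀ a : A, Tendsto (fun t => s t • a) l (𝓝 0) := fun a => by
    simpa using hs0.smul_const a
  have h0 : B₀ - A₀ = 0 := by
    refine aux (f := fun t => (B₀ - A₀) + s t • (B₁ - A₁)) (by simpa using (hsm _).const_add _) ?_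
    have := h.trans (isBigO_pow_of_le hs0 (show 1 ≤ 2 by norm_num))
    simp only [pow_one] at this
    refine this.congr_left fun t => ?_
    rw [smul_sub]; abel
  refine ⟨(sub_eq_zero.mp h0).symm, (sub_eq_zero.mp ?_).symm⟩
  refine aux (tendsto_const_nhds (x := B₁ - A₁)) ?_
  have h2 : (fun t => (s t)⁻¹ • (s t • (B₁ - A₁))) =O[l] fun t => (s t)⁻¹ • (s t ^ 2) := by
    refine (isBigO_refl (fun t => (s t)⁻¹) l).smul (h.congr_left fun t => ?_)
    rw [sub_eq_zero.mp h0, smul_sub]; abel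
  refine h2.congr' ?_ ?_
  · filter_upwards [hne] with t ht
    rw [smul_smul, inv_mul_cancel₀ ht, one_smul]
  · filter_upwards [hne] with t ht
    rw [smul_eq_mul]; field_simp

theorem HasExpansion.congr {f g : α → A} {A₀ A₁ : A} (hf : HasExpansion l s f A₀ A₁)
    (h : f =ᶠ[l] g) : HasExpansion l s g A₀ A₁ :=
  IsBigO.congr' hf (h.mono fun t ht => by simp only [ht]) EventuallyEq.rfl

theorem HasExpansion.hasExpansionTwo {f : α → A} {X : A} (hf : HasExpansion l s f 1 X) :
    HasExpansionTwo l s f X (fun t => f t - (1 + s t • X)) :=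
  ⟨by simp [isBigO_zero], hf⟩

/-- The second order parts stay arbitrary functions of size O(s²), because the R-matrices need not
possess a coefficient at that order. Only the product X Y is new. -/
theorem HasExpansionTwo.mul {f g : α → A} {X Y : A} {e e' : α → A} (hs : Tendsto s l (𝓝 0))
    (hf : HasExpansionTwo l s f X e) (hg : HasExpansionTwo l s g Y e') :
    HasExpansionTwo l s (fun t => f t * g t) (X + Y)
      (fun t => e t + e' t + s t ^ 2 • (X * Y)) := by
  obtain ⟨hf, he⟩ := hf
  obtain ⟨hg, he'⟩ := hg
  have hsX := isBigO_smul_const (s := s) (l := l) X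
  have hsY := isBigO_smul_const (s := s) (l := l) Y
  have hF : (fun t => 1 + s t • X + e t) =O[l] fun t => s t ^ 0 :=
    ((isBigO_const_pow_zero 1).add (hsX.trans (isBigO_pow_of_le hs (Nat.zero_le 1)))).add
      (he.trans (isBigO_pow_of_le hs (Nat.zero_le 2)))
  have hG : (fun t => 1 + s t • Y + e' t) =O[l] fun t => s t ^ 0 :=
    ((isBigO_const_pow_zero 1).add (hsY.trans (isBigO_pow_of_le hs (Nat.zero_le 1)))).add
      (he'.trans (isBigO_pow_of_le hs (Nat.zero_le 2)))
  have hg0 : g =O[l] fun t => s t ^ 0 :=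
    ((hg.trans (isBigO_pow_of_le hs (Nat.zero_le 3))).add hG).congr_left fun t => by abel
  refine ⟨?_, ?_⟩
  · have h1 := isBigO_mul_pow hf hg0
    have h2 := isBigO_mul_pow' (k := 3) hs hF hg
    have h3 := isBigO_mul_pow hsX he'
    have h4 := isBigO_mul_pow he hsY
    have h5 := isBigO_mul_pow' (k := 3) hs he he'
    refine ((((h1.add h2).add h3).add h4).add h5).congr_left fun t => ?_
    simp only [mul_add, add_mul, mul_sub, sub_mul, smul_add, smul_mul_assoc, mul_smul_comm, mul_one,
      one_mul, smul_smul, ← pow_two]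
    abel
  · refine (he.add he').add ?_
    refine IsBigO.of_bound ‖X * Y‖ (Eventually.of_forall fun t => ?_)
    rw [norm_smul, mul_comm]

theorem HasExpansionTwo.sub_isBigO {f g : α → A} {X : A} {e e' : α → A}
    (hf : HasExpansionTwo l s f X e) (hg : HasExpansionTwo l s g X e') (h : f =ᶠ[l] g) :
    (fun t => e t - e' t) =O[l] fun t => s t ^ 3 := by
  refine (hg.1.sub hf.1).congr' ?_ EventuallyEq.rfl
  filter_upwards [h] with t ht
  rw [ht]; abel

end Expansion

/-! ### Expansions at infinity of the boundary Yang–Baxter equation -/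

section Asymptotics

variable {A : Type*} [NormedRing A] [NormedAlgebra ℂ A]

theorem tendsto_inv_cobounded_zero : Tendsto (fun u : ℂ => u⁻¹) (cobounded ℂ) (𝓝 0) :=
  tendsto_inv₀_cobounded

theorem HasExpansion.comp_mul {f : ℂ → A} {A₀ A₁ : A}
    (hf : HasExpansion (cobounded ℂ) (fun u => u⁻¹) f A₀ A₁) {c : ℂ} (hc : c ≠ 0) :
    HasExpansion (cobounded ℂ) (fun u => u⁻¹) (fun u => f (c * u)) A₀ (c⁻¹ • A₁) := by
  have h := IsBigO.comp_tendsto hf (tendsto_mul_left_cobounded hc)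
  have h1 : (fun u : ℂ => (c * u)⁻¹ ^ 2) =O[cobounded ℂ] fun u => u⁻¹ ^ 2 := by
    simp only [mul_inv, mul_pow]
    exact isBigO_const_mul_self _ _ _
  refine (h.trans h1).congr_left fun u => ?_
  simp [smul_smul, mul_comm]

theorem isBigO_inv_add_const (c : ℂ) :
    (fun u : ℂ => (u + c)⁻¹) =O[cobounded ℂ] fun u => u⁻¹ := by
  refine IsBigO.of_bound 2 ?_
  filter_upwards [tendsto_norm_cobounded_atTop.eventually_ge_atTop (2 * ‖c‖ + 1)] with u hu
  have h1 : ‖u‖ ≤ ‖u + c‖ + ‖c‖ := by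
    simpa using norm_sub_le (u + c) c
  have h2 : 0 ≤ ‖c‖ := norm_nonneg c
  rw [norm_inv, norm_inv, ← div_eq_mul_inv, inv_eq_one_div,
    div_le_div_iff₀ (by linarith) (by linarith)]
  linarith

/-- A shift changes 1/u by O(u⁻²) only, so both coefficients survive. -/
theorem HasExpansion.comp_add {f : ℂ → A} {A₀ A₁ : A}
    (hf : HasExpansion (cobounded ℂ) (fun u => u⁻¹) f A₀ A₁) (c : ℂ) :
    HasExpansion (cobounded ℂ) (fun u => u⁻¹) (fun u => f (u + c)) A₀ A₁ := by
  have h := IsBigO.comp_tendsto hf (tendsto_add_const_cobounded c)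
  have h1 := h.trans ((isBigO_inv_add_const c).pow 2)
  have h2 : (fun u : ℂ => ((u + c)⁻¹ - u⁻¹) • A₁) =O[cobounded ℂ] fun u => u⁻¹ ^ 2 := by
    have h3 : (fun u : ℂ => (u + c)⁻¹ - u⁻¹) =O[cobounded ℂ] fun u => u⁻¹ ^ 2 := by
      have h4 := ((isBigO_inv_add_const c).mul (isBigO_refl (fun u : ℂ => u⁻¹) _)).const_mul_left
        (-c)
      refine h4.congr' ?_ (Eventually.of_forall fun u => by simp [pow_two])
      have h5 : ∀ᶠ u : ℂ in cobounded ℂ, u ≠ 0 := eventually_ne_cobounded 0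
      filter_upwards [h5, (tendsto_add_const_cobounded c).eventually h5] with u hu hu'
      field_simp
      ring
    simpa using h3.smul (isBigO_const_const A₁ (one_ne_zero (α := ℂ)) (cobounded ℂ))
  refine (h1.add h2).congr_left fun u => ?_
  simp only [Function.comp, sub_smul]
  abel

variable {S T : Set ℂ} {R₁ R₂ R₃ R₄ L M : ℂ → A} {C₁ C₂ C₃ C₄ L₀ L₁ M₀ M₁ : A}

/-- The coefficients of `1` and of `1/u` in a boundary Yang-Baxter equation, for fixed `v`. -/
theorem reflection_first_order (hS : S ∈ cobounded ℂ) (hT : T ∈ cobounded ℂ)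
    (h₁ : HasExpansion (cobounded ℂ) (fun u => u⁻¹) R₁ 1 C₁)
    (h₂ : HasExpansion (cobounded ℂ) (fun u => u⁻¹) R₂ 1 C₂)
    (h₃ : HasExpansion (cobounded ℂ) (fun u => u⁻¹) R₃ 1 C₃)
    (h₄ : HasExpansion (cobounded ℂ) (fun u => u⁻¹) R₄ 1 C₄)
    (hL : HasExpansion (cobounded ℂ) (fun u => u⁻¹) L L₀ L₁)
    (eqn : ∀ u ∈ T, ∀ v ∈ T, u - v ∈ S → u + v ∈ S →
      R₁ (u - v) * L u * R₂ (u + v) * M v = M v * R₃ (u + v) * L u * R₄ (u - v))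
    {v : ℂ} (hv : v ∈ T) :
    L₀ * M v = M v * L₀ ∧
      C₁ * L₀ * M v + L₁ * M v + L₀ * C₂ * M v = M v * C₃ * L₀ + M v * L₁ + M v * L₀ * C₄ := by
  have hs := tendsto_inv_cobounded_zero
  have hl := (((h₁.comp_add (-v)).mul hs hL).mul hs (h₂.comp_add v)).mul hs
    (HasExpansion.const (M v))
  have hr := (((HasExpansion.const (M v)).mul hs (h₃.comp_add v)).mul hs hL).mul hs
    (h₄.comp_add (-v))
  have heq : (fun u => R₁ (u + -v) * L u * R₂ (u + v) * M v) =ᶠ[cobounded ℂ]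
      fun u => M v * R₃ (u + v) * L u * R₄ (u + -v) := by
    filter_upwards [hT, (tendsto_add_const_cobounded (-v)).eventually_mem hS,
      (tendsto_add_const_cobounded v).eventually_mem hS] with u h1 h2 h3
    simpa [sub_eq_add_neg] using eqn u h1 v hv (by simpa [sub_eq_add_neg] using h2) h3
  have := (hl.congr heq).unique tendsto_inv₀_cobounded' hr
  refine ⟨by simpa using this.1, ?_⟩
  simpa [add_mul, mul_add, mul_assoc, add_assoc] using this.2

/-- The sum of the commutators of the first order coefficients of the four factors of a boundary
Yang-Baxter equation, in the regime where `u + v = c (u - v)`. -/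
def commutatorSum (c : ℂ) (C C' X Y : A) : A :=
  (2 / (c + 1)) • (C * X - X * C) + c⁻¹ • (C * C' - C' * C) + (2 / (c - 1)) • (C * Y - Y * C)
    + (2 / (c + 1) * c⁻¹) • (X * C' - C' * X) + (2 / (c + 1) * (2 / (c - 1))) • (X * Y - Y * X)
    + (2 / (c - 1) * c⁻¹) • (C' * Y - Y * C')

variable {C C' X Y : A}

/-- Put u = (c+1)t/2 and v = (c−1)t/2, so that u − v = t and u + v = c t. The second order
remainders of L and M occur on both sides and cancel; the products of first order terms in opposite
orders leave commutators. -/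
theorem reflection_second_order (hS : S ∈ cobounded ℂ) (hT : T ∈ cobounded ℂ)
    (h₁ : HasExpansion (cobounded ℂ) (fun u => u⁻¹) R₁ 1 C)
    (h₂ : HasExpansion (cobounded ℂ) (fun u => u⁻¹) R₂ 1 C')
    (h₃ : HasExpansion (cobounded ℂ) (fun u => u⁻¹) R₃ 1 C')
    (h₄ : HasExpansion (cobounded ℂ) (fun u => u⁻¹) R₄ 1 C)
    (hL : HasExpansion (cobounded ℂ) (fun u => u⁻¹) L 1 X)
    (hM : HasExpansion (cobounded ℂ) (fun u => u⁻¹) M 1 Y)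
    (eqn : ∀ u ∈ T, ∀ v ∈ T, u - v ∈ S → u + v ∈ S →
      R₁ (u - v) * L u * R₂ (u + v) * M v = M v * R₃ (u + v) * L u * R₄ (u - v))
    {c : ℂ} (hc : c ≠ 0) (hc₁ : c + 1 ≠ 0) (hc₂ : c - 1 ≠ 0) :
    (fun t : ℂ => (R₁ t - R₄ t) + (R₂ (c * t) - R₃ (c * t)) + t⁻¹ ^ 2 • commutatorSum c C C' X Y)
      =O[cobounded ℂ] fun t => t⁻¹ ^ 3 := by
  have hs := tendsto_inv_cobounded_zero
  have hp : (c + 1) / 2 ≠ 0 := div_ne_zero hc₁ two_ne_zero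
  have hq : (c - 1) / 2 ≠ 0 := div_ne_zero hc₂ two_ne_zero
  have e₁ := h₁.hasExpansionTwo
  have e₂ := (h₂.comp_mul hc).hasExpansionTwo
  have e₃ := (h₃.comp_mul hc).hasExpansionTwo
  have e₄ := h₄.hasExpansionTwo
  have eL := (hL.comp_mul hp).hasExpansionTwo
  have eM := (hM.comp_mul hq).hasExpansionTwo
  have hl := ((e₁.mul hs eL).mul hs e₂).mul hs eM
  have hr := ((eM.mul hs e₃).mul hs eL).mul hs e₄
  have hX : ((c - 1) / 2)⁻¹ • Y + c⁻¹ • C' + ((c + 1) / 2)⁻¹ • X + C =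
      C + ((c + 1) / 2)⁻¹ • X + c⁻¹ • C' + ((c - 1) / 2)⁻¹ • Y := by abel
  rw [hX] at hr
  refine (hl.sub_isBigO hr ?_).congr_left fun t => ?_
  · have m1 := (tendsto_mul_left_cobounded hp).eventually_mem hT
    have m2 := (tendsto_mul_left_cobounded hq).eventually_mem hT
    have m3 := (tendsto_mul_left_cobounded hc).eventually_mem hS
    filter_upwards [m1, m2, m3, hS] with t h1 h2 h3 h4
    have i1 : (c + 1) / 2 * t - (c - 1) / 2 * t = t := by ring
    have i2 : (c + 1) / 2 * t + (c - 1) / 2 * t = c * t := by ring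
    have := eqn _ h1 _ h2 (by rwa [i1]) (by rwa [i2])
    rwa [i1, i2] at this
  · simp only [commutatorSum, inv_div, add_mul, smul_add, smul_sub, smul_mul_assoc,
      mul_smul_comm, smul_smul]
    module

/-- A bounded second order difference of R-matrices cannot compensate a commutator that scales
like `1/c`. -/
theorem eq_zero_of_reflection (hS : S ∈ cobounded ℂ) (hT : T ∈ cobounded ℂ)
    (h₁ : HasExpansion (cobounded ℂ) (fun u => u⁻¹) R₁ 1 C)
    (h₂ : HasExpansion (cobounded ℂ) (fun u => u⁻¹) R₂ 1 C')
    (h₃ : HasExpansion (cobounded ℂ) (fun u => u⁻¹) R₃ 1 C')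
    (h₄ : HasExpansion (cobounded ℂ) (fun u => u⁻¹) R₄ 1 C)
    (hL : HasExpansion (cobounded ℂ) (fun u => u⁻¹) L 1 X)
    (hM : HasExpansion (cobounded ℂ) (fun u => u⁻¹) M 1 Y)
    (eqn : ∀ u ∈ T, ∀ v ∈ T, u - v ∈ S → u + v ∈ S →
      R₁ (u - v) * L u * R₂ (u + v) * M v = M v * R₃ (u + v) * L u * R₄ (u - v))
    {N : A} (hN : ∀ c : ℂ, c ≠ 0 → c + 1 ≠ 0 → c - 1 ≠ 0 →
      commutatorSum c C C' X Y = (2 / c) • N) : N = 0 := by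
  have hD : (fun w => R₂ w - R₃ w) =O[cobounded ℂ] fun w => w⁻¹ ^ 2 :=
    (IsBigO.sub h₂ h₃).congr_left fun w => by abel
  obtain ⟨B, hB⟩ := hD.bound
  -- Subtracting the relations for c = r and c = −r removes R₁ − R₄ and leaves (4/r) t⁻² N. The two
  -- differences R₂ − R₃ are at most B/(r|t|)² each, which is one power of r smaller.
  have key : ∀ r : ℝ, 1 < r → ‖N‖ ≤ B / 2 * r⁻¹ := by
    intro r hr
    have hr0 : (r : ℂ) ≠ 0 := by exact_mod_cast (by linarith : r ≠ 0)
    have hr1 : (r : ℂ) + 1 ≠ 0 := by exact_mod_cast (by linarith : r + 1 ≠ 0)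
    have hr2 : (r : ℂ) - 1 ≠ 0 := by
      have : r - 1 ≠ 0 := by linarith
      exact_mod_cast this
    have hn0 : (-r : ℂ) ≠ 0 := neg_ne_zero.mpr hr0
    have hn1 : (-r : ℂ) + 1 ≠ 0 := by
      rw [neg_add_eq_sub, ← neg_sub]; exact neg_ne_zero.mpr hr2
    have hn2 : (-r : ℂ) - 1 ≠ 0 := by
      rw [← neg_add']; exact neg_ne_zero.mpr hr1
    have a := reflection_second_order hS hT h₁ h₂ h₃ h₄ hL hM eqn hr0 hr1 hr2
    have b := reflection_second_order hS hT h₁ h₂ h₃ h₄ hL hM eqn hn0 hn1 hn2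
    rw [hN _ hr0 hr1 hr2] at a
    rw [hN _ hn0 hn1 hn2] at b
    obtain ⟨B', hB'⟩ := (a.sub b).bound
    have lim : Tendsto (fun t : ℂ => B / 2 * r⁻¹ + (r / 4 * B') * ‖t⁻¹‖) (cobounded ℂ)
        (𝓝 (B / 2 * r⁻¹ + (r / 4 * B') * 0)) := by
      refine tendsto_const_nhds.add (Tendsto.const_mul _ ?_)
      simpa using tendsto_inv_cobounded_zero.norm
    rw [mul_zero, add_zero] at lim
    refine ge_of_tendsto lim ?_
    filter_upwards [hB', (tendsto_mul_left_cobounded hr0).eventually hB,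
      (tendsto_mul_left_cobounded hn0).eventually hB, eventually_ne_cobounded (0 : ℂ)]
      with t h1 h2 h3 ht
    have ht' : 0 < ‖t‖ := norm_pos_iff.mpr ht
    set d₁ := R₂ (r * t) - R₃ (r * t)
    set d₂ := R₂ (-r * t) - R₃ (-r * t)
    have hid : (4 * (r : ℂ)⁻¹ * t⁻¹ ^ 2) • N =
        (R₁ t - R₄ t + d₁ + t⁻¹ ^ 2 • (2 / (r : ℂ)) • N
          - (R₁ t - R₄ t + d₂ + t⁻¹ ^ 2 • (2 / (-r : ℂ)) • N)) - d₁ + d₂ := by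
      have : (2 / (-r : ℂ)) = - (2 / r) := by rw [div_neg]
      rw [this]
      module
    have hle : ‖(4 * (r : ℂ)⁻¹ * t⁻¹ ^ 2) • N‖ ≤
        B' * ‖t⁻¹ ^ 3‖ + B * ‖((r : ℂ) * t)⁻¹ ^ 2‖ + B * ‖(-(r : ℂ) * t)⁻¹ ^ 2‖ := by
      rw [hid]
      exact (norm_add_le _ _).trans (add_le_add ((norm_sub_le _ _).trans (add_le_add h1 h2)) h3)
    have hrn : ‖(r : ℂ)‖ = r := by simp [abs_of_pos (by linarith : 0 < r)]
    simp only [norm_smul, norm_mul, norm_inv, norm_pow, norm_neg, hrn, RCLike.norm_ofNat] at hle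
    have hr' : 0 < r := by linarith
    -- The factor r|t|²/4 normalises the coefficient of ‖N‖ to 1; the error then vanishes as t → ∞
    -- with r fixed.
    have hm := mul_le_mul_of_nonneg_left hle (by positivity : 0 ≤ r / 4 * ‖t‖ ^ 2)
    have e1 : r / 4 * ‖t‖ ^ 2 * (4 * r⁻¹ * ‖t‖⁻¹ ^ 2 * ‖N‖) = ‖N‖ := by field_simp
    have e2 : r / 4 * ‖t‖ ^ 2 *
        (B' * ‖t‖⁻¹ ^ 3 + B * (r * ‖t‖)⁻¹ ^ 2 + B * (r * ‖t‖)⁻¹ ^ 2)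
        = B / 2 * r⁻¹ + r / 4 * B' * ‖t‖⁻¹ := by field_simp; ring
    rw [e1, e2] at hm
    simpa using hm
  have lim : Tendsto (fun r : ℝ => B / 2 * r⁻¹) atTop (𝓝 0) := by
    simpa using tendsto_inv_atTop_zero.const_mul (B / 2)
  have : ‖N‖ ≤ 0 := ge_of_tendsto lim ((eventually_gt_atTop 1).mono key)
  simpa using this

end Asymptotics

/-! ### Tensor legs as algebra homomorphisms -/

section LegHoms

variable {l m n : Type*} [DecidableEq l] [DecidableEq m] [DecidableEq n]
  [Fintype l] [Fintype m] [Fintype n]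

theorem leg12_mul (A B : Matrix (l × m) (l × m) ℂ) :
    (leg12 (A * B) : Matrix (l × m × n) (l × m × n) ℂ) = leg12 A * leg12 B := by
  ext ⟨i, j, k⟩ ⟨i', j', k'⟩
  simp [leg12, Matrix.mul_apply, Fintype.sum_prod_type]

theorem leg13_mul (A B : Matrix (l × n) (l × n) ℂ) :
    (leg13 (A * B) : Matrix (l × m × n) (l × m × n) ℂ) = leg13 A * leg13 B := by
  ext ⟨i, j, k⟩ ⟨i', j', k'⟩
  by_cases h : j = j' <;> simp [leg13, Matrix.mul_apply, Fintype.sum_prod_type, h]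

theorem leg23_mul (A B : Matrix (m × n) (m × n) ℂ) :
    (leg23 (A * B) : Matrix (l × m × n) (l × m × n) ℂ) = leg23 A * leg23 B := by
  ext ⟨i, j, k⟩ ⟨i', j', k'⟩
  by_cases h : i = i' <;> simp [leg23, Matrix.mul_apply, Fintype.sum_prod_type, h]

variable (l m n)

/-- `leg12` as a homomorphism of algebras. -/
def leg12Hom : Matrix (l × m) (l × m) ℂ →ₐ[ℂ] Matrix (l × m × n) (l × m × n) ℂ :=
  AlgHom.ofLinearMap
    { toFun := leg12
      map_add' := fun A B => by ext p q; by_cases h : p.2.2 = q.2.2 <;> simp [leg12, h]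
      map_smul' := fun c A => by ext p q; by_cases h : p.2.2 = q.2.2 <;> simp [leg12, h] }
    (by
      ext ⟨i, j, k⟩ ⟨i', j', k'⟩
      by_cases h : k = k' <;> simp [leg12, Matrix.one_apply, h])
    leg12_mul

/-- `leg13` as a homomorphism of algebras. -/
def leg13Hom : Matrix (l × n) (l × n) ℂ →ₐ[ℂ] Matrix (l × m × n) (l × m × n) ℂ :=
  AlgHom.ofLinearMap
    { toFun := leg13
      map_add' := fun A B => by ext p q; by_cases h : p.2.1 = q.2.1 <;> simp [leg13, h]
      map_smul' := fun c A => by ext p q; by_cases h : p.2.1 = q.2.1 <;> simp [leg13, h] }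
    (by
      ext ⟨i, j, k⟩ ⟨i', j', k'⟩
      by_cases h : j = j' <;> simp [leg13, Matrix.one_apply, h])
    leg13_mul

/-- `leg23` as a homomorphism of algebras. -/
def leg23Hom : Matrix (m × n) (m × n) ℂ →ₐ[ℂ] Matrix (l × m × n) (l × m × n) ℂ :=
  AlgHom.ofLinearMap
    { toFun := leg23
      map_add' := fun A B => by ext p q; by_cases h : p.1 = q.1 <;> simp [leg23, h]
      map_smul' := fun c A => by ext p q; by_cases h : p.1 = q.1 <;> simp [leg23, h] }
    (by
      ext ⟨i, j, k⟩ ⟨i', j', k'⟩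
      by_cases h : i = i' <;> simp [leg23, Matrix.one_apply, h])
    leg23_mul

/-- A matrix acting on the left tensor factor. -/
def leftHom : Matrix l l ℂ →ₐ[ℂ] Matrix (l × m) (l × m) ℂ :=
  AlgHom.ofLinearMap
    { toFun := fun A => A ⊗ₖ 1
      map_add' := fun A B => Matrix.add_kronecker A B 1
      map_smul' := fun c A => Matrix.smul_kronecker c A 1 }
    Matrix.one_kronecker_one
    (fun A B => by simp [← Matrix.mul_kronecker_mul])

/-- A matrix acting on the right tensor factor. -/
def rightHom : Matrix m m ℂ →ₐ[ℂ] Matrix (l × m) (l × m) ℂ :=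
  AlgHom.ofLinearMap
    { toFun := fun A => 1 ⊗ₖ A
      map_add' := fun A B => Matrix.kronecker_add 1 A B
      map_smul' := fun c A => Matrix.kronecker_smul c 1 A }
    Matrix.one_kronecker_one
    (fun A B => by simp [← Matrix.mul_kronecker_mul])

/-- A matrix acting on the first of three tensor factors. -/
def leg1 : Matrix l l ℂ →ₐ[ℂ] Matrix (l × m × n) (l × m × n) ℂ :=
  (leg12Hom l m n).comp (leftHom l m)

/-- A matrix acting on the second of three tensor factors. -/
def leg2 : Matrix m m ℂ →ₐ[ℂ] Matrix (l × m × n) (l × m × n) ℂ :=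
  (leg12Hom l m n).comp (rightHom l m)

/-- A matrix acting on the third of three tensor factors. -/
def leg3 : Matrix n n ℂ →ₐ[ℂ] Matrix (l × m × n) (l × m × n) ℂ :=
  (leg13Hom l m n).comp (rightHom l n)

variable {l m n}

theorem leftHom_apply (A : Matrix l l ℂ) : leftHom l m A = A ⊗ₖ 1 := rfl

theorem rightHom_apply (A : Matrix m m ℂ) : rightHom l m A = 1 ⊗ₖ A := rfl

theorem leftHom_mul_rightHom (A : Matrix l l ℂ) (B : Matrix m m ℂ) :
    leftHom l m A * rightHom l m B = A ⊗ₖ B := by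
  simp [leftHom_apply, rightHom_apply, ← Matrix.mul_kronecker_mul]

theorem rightHom_mul_leftHom (A : Matrix l l ℂ) (B : Matrix m m ℂ) :
    rightHom l m B * leftHom l m A = A ⊗ₖ B := by
  simp [leftHom_apply, rightHom_apply, ← Matrix.mul_kronecker_mul]

theorem leg12Hom_leftHom (A : Matrix l l ℂ) :
    leg12Hom l m n (leftHom l m A) = leg1 l m n A := rfl

theorem leg12Hom_rightHom (A : Matrix m m ℂ) :
    leg12Hom l m n (rightHom l m A) = leg2 l m n A := rfl

theorem leg13Hom_rightHom (A : Matrix n n ℂ) :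
    leg13Hom l m n (rightHom l n A) = leg3 l m n A := rfl

theorem leg13Hom_leftHom (A : Matrix l l ℂ) :
    leg13Hom l m n (leftHom l n A) = leg1 l m n A := by
  change leg13 (A ⊗ₖ 1) = leg12 (A ⊗ₖ 1)
  ext ⟨i, j, k⟩ ⟨i', j', k'⟩
  by_cases h : j = j' <;> by_cases h' : k = k' <;>
    simp [leg12, leg13, h, h']

theorem leg23Hom_leftHom (A : Matrix m m ℂ) :
    leg23Hom l m n (leftHom m n A) = leg2 l m n A := by
  change leg23 (A ⊗ₖ 1) = leg12 (1 ⊗ₖ A)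
  ext ⟨i, j, k⟩ ⟨i', j', k'⟩
  by_cases h : i = i' <;> by_cases h' : k = k' <;>
    simp [leg12, leg23, h, h']

theorem leg23Hom_rightHom (A : Matrix n n ℂ) :
    leg23Hom l m n (rightHom m n A) = leg3 l m n A := by
  change leg23 (1 ⊗ₖ A) = leg13 (1 ⊗ₖ A)
  ext ⟨i, j, k⟩ ⟨i', j', k'⟩
  by_cases h : i = i' <;> by_cases h' : j = j' <;>
    simp [leg13, leg23, h, h']

theorem leg12Hom_kronecker (A : Matrix l l ℂ) (B : Matrix m m ℂ) :
    leg12Hom l m n (A ⊗ₖ B) = leg1 l m n A * leg2 l m n B := by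
  rw [← leftHom_mul_rightHom, map_mul, leg12Hom_leftHom, leg12Hom_rightHom]

theorem leg13Hom_kronecker (A : Matrix l l ℂ) (B : Matrix n n ℂ) :
    leg13Hom l m n (A ⊗ₖ B) = leg1 l m n A * leg3 l m n B := by
  rw [← leftHom_mul_rightHom, map_mul, leg13Hom_leftHom, leg13Hom_rightHom]

theorem leg23Hom_kronecker (A : Matrix m m ℂ) (B : Matrix n n ℂ) :
    leg23Hom l m n (A ⊗ₖ B) = leg2 l m n A * leg3 l m n B := by
  rw [← leftHom_mul_rightHom, map_mul, leg23Hom_leftHom, leg23Hom_rightHom]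

theorem leg1_mul_leg23Hom_apply (A : Matrix l l ℂ) (B : Matrix (m × n) (m × n) ℂ)
    (i j : l) (p q : m × n) :
    (leg1 l m n A * leg23Hom l m n B) (i, p) (j, q) = A i j * B p q := by
  change (leg12 (A ⊗ₖ 1) * leg23 B : Matrix (l × m × n) (l × m × n) ℂ) (i, p) (j, q) = _
  obtain ⟨p₁, p₂⟩ := p
  simp [leg12, leg23, Matrix.mul_apply, Fintype.sum_prod_type, Matrix.one_apply]

theorem leg23Hom_mul_leg1_apply (A : Matrix l l ℂ) (B : Matrix (m × n) (m × n) ℂ)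
    (i j : l) (p q : m × n) :
    (leg23Hom l m n B * leg1 l m n A) (i, p) (j, q) = A i j * B p q := by
  change (leg23 B * leg12 (A ⊗ₖ 1) : Matrix (l × m × n) (l × m × n) ℂ) (i, p) (j, q) = _
  obtain ⟨p₁, p₂⟩ := p
  obtain ⟨q₁, q₂⟩ := q
  simp [leg12, leg23, Matrix.mul_apply, Fintype.sum_prod_type, Matrix.one_apply, mul_comm]

theorem leg1_commute_leg23Hom (A : Matrix l l ℂ) (B : Matrix (m × n) (m × n) ℂ) :
    Commute (leg1 l m n A) (leg23Hom l m n B) := by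
  ext ⟨i, p⟩ ⟨j, q⟩
  rw [leg1_mul_leg23Hom_apply, leg23Hom_mul_leg1_apply]

theorem leg2_commute_leg13Hom (A : Matrix m m ℂ) (B : Matrix (l × n) (l × n) ℂ) :
    Commute (leg2 l m n A) (leg13Hom l m n B) := by
  change (leg12 (1 ⊗ₖ A) * leg13 B : Matrix (l × m × n) (l × m × n) ℂ) =
    leg13 B * leg12 (1 ⊗ₖ A)
  ext ⟨i, j, k⟩ ⟨i', j', k'⟩
  simp [leg12, leg13, Matrix.mul_apply, Fintype.sum_prod_type, Matrix.one_apply, mul_comm]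

theorem leg1_commute_leg2 (A : Matrix l l ℂ) (B : Matrix m m ℂ) :
    Commute (leg1 l m n A) (leg2 l m n B) := by
  rw [← leg23Hom_leftHom]; exact leg1_commute_leg23Hom _ _

theorem leg1_commute_leg3 (A : Matrix l l ℂ) (B : Matrix n n ℂ) :
    Commute (leg1 l m n A) (leg3 l m n B) := by
  rw [← leg23Hom_rightHom]; exact leg1_commute_leg23Hom _ _

theorem leg2_commute_leg3 (A : Matrix m m ℂ) (B : Matrix n n ℂ) :
    Commute (leg2 l m n A) (leg3 l m n B) := by
  rw [← leg13Hom_rightHom]; exact leg2_commute_leg13Hom _ _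

theorem leg12Hom_injective [Nonempty n] : Function.Injective (leg12Hom l m n) := by
  intro A B h
  obtain ⟨k⟩ := ‹Nonempty n›
  ext ⟨i, j⟩ ⟨i', j'⟩
  have := congrFun (congrFun h (i, j, k)) (i', j', k)
  change leg12 A (i, j, k) (i', j', k) = leg12 B (i, j, k) (i', j', k) at this
  simpa [leg12] using this

theorem flip21_kronecker (A : Matrix l l ℂ) (B : Matrix m m ℂ) : flip21 (A ⊗ₖ B) = B ⊗ₖ A := by
  ext ⟨i, j⟩ ⟨i', j'⟩
  simp [flip21, mul_comm]

theorem leftHom_injective [Nonempty m] : Function.Injective (leftHom l m) := by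
  intro A B h
  obtain ⟨k⟩ := ‹Nonempty m›
  ext i j
  have := congrFun (congrFun h (i, k)) (j, k)
  simpa [leftHom_apply] using this

end LegHoms

/-! ### Blocks of a K-matrix and Schur's lemma -/

section Blocks

variable {d dB : ℕ}

theorem leg13Hom_mul_leg23Hom_apply (A B : Matrix (Fin d × Fin dB) (Fin d × Fin dB) ℂ)
    (i j : Fin d) (p q : Fin d × Fin dB) :
    (leg13Hom (Fin d) (Fin d) (Fin dB) A * leg23Hom (Fin d) (Fin d) (Fin dB) B) (i, p) (j, q) =
      (rightHom (Fin d) (Fin dB) (block A i j) * B) p q := by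
  change (leg13 A * leg23 B : Matrix (Fin d × Fin d × Fin dB) (Fin d × Fin d × Fin dB) ℂ)
    (i, p) (j, q) =
      (((1 : Matrix (Fin d) (Fin d) ℂ) ⊗ₖ block A i j) * B :
        Matrix (Fin d × Fin dB) (Fin d × Fin dB) ℂ) p q
  obtain ⟨p₁, p₂⟩ := p
  simp [leg13, leg23, block, Matrix.mul_apply, Fintype.sum_prod_type, Matrix.one_apply]

theorem leg23Hom_mul_leg13Hom_apply (A B : Matrix (Fin d × Fin dB) (Fin d × Fin dB) ℂ)
    (i j : Fin d) (p q : Fin d × Fin dB) :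
    (leg23Hom (Fin d) (Fin d) (Fin dB) B * leg13Hom (Fin d) (Fin d) (Fin dB) A) (i, p) (j, q) =
      (B * rightHom (Fin d) (Fin dB) (block A i j)) p q := by
  change (leg23 B * leg13 A : Matrix (Fin d × Fin d × Fin dB) (Fin d × Fin d × Fin dB) ℂ)
    (i, p) (j, q) =
      (B * ((1 : Matrix (Fin d) (Fin d) ℂ) ⊗ₖ block A i j) :
        Matrix (Fin d × Fin dB) (Fin d × Fin dB) ℂ) p q
  obtain ⟨p₁, p₂⟩ := p
  obtain ⟨q₁, q₂⟩ := q
  simp [leg13, leg23, block, Matrix.mul_apply, Fintype.sum_prod_type, Matrix.one_apply]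

theorem rightHom_mul_apply (Q : Matrix (Fin dB) (Fin dB) ℂ)
    (B : Matrix (Fin d × Fin dB) (Fin d × Fin dB) ℂ) (i j : Fin d) (b c : Fin dB) :
    (rightHom (Fin d) (Fin dB) Q * B) (i, b) (j, c) = (Q * block B i j) b c := by
  simp [rightHom_apply, block, Matrix.mul_apply, Fintype.sum_prod_type, Matrix.one_apply]

theorem mul_rightHom_apply (Q : Matrix (Fin dB) (Fin dB) ℂ)
    (B : Matrix (Fin d × Fin dB) (Fin d × Fin dB) ℂ) (i j : Fin d) (b c : Fin dB) :
    (B * rightHom (Fin d) (Fin dB) Q) (i, b) (j, c) = (block B i j * Q) b c := by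
  simp [rightHom_apply, block, Matrix.mul_apply, Fintype.sum_prod_type, Matrix.one_apply]

variable {T : Set ℂ} {K : ℂ → Matrix (Fin d × Fin dB) (Fin d × Fin dB) ℂ}

/-- Schur's lemma for irreducible K-matrices. -/
theorem IsIrreducibleK.exists_eq_smul_one (h : IsIrreducibleK T K)
    {Q : Matrix (Fin dB) (Fin dB) ℂ}
    (hQ : ∀ u ∈ T, rightHom (Fin d) (Fin dB) Q * K u = K u * rightHom (Fin d) (Fin dB) Q) :
    ∃ c : ℂ, Q = c • 1 := by
  obtain ⟨hpos, h⟩ := h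
  have : Nonempty (Fin dB) := ⟨⟨0, hpos⟩⟩
  obtain ⟨c, hc⟩ := Module.End.exists_eigenvalue (Matrix.toLin' Q)
  -- An eigenspace of Q is invariant under every block of K, and it is nonzero, so irreducibility
  -- makes it everything.
  have hW := h (Module.End.eigenspace (Matrix.toLin' Q) c) fun u hu i j w hw => by
    rw [Module.End.mem_eigenspace_iff, Matrix.toLin'_apply] at hw ⊢
    have hcomm : Q * block (K u) i j = block (K u) i j * Q := by
      ext b c
      rw [← rightHom_mul_apply, ← mul_rightHom_apply, hQ u hu]
    rw [Matrix.mulVec_mulVec, hcomm, ← Matrix.mulVec_mulVec, hw, Matrix.mulVec_smul]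
  rcases hW with hW | hW
  · exact absurd hW hc
  · refine ⟨c, Matrix.toLin'.injective (LinearMap.ext fun w => ?_)⟩
    have hw : w ∈ Module.End.eigenspace (Matrix.toLin' Q) c := hW ▸ Submodule.mem_top
    rw [Module.End.mem_eigenspace_iff] at hw
    rw [hw]; simp

/-- Taking matrix entries in leg 1 shows that each block of Q commutes with K on the boundary leg,
so Schur's lemma applies block by block. -/
theorem IsIrreducibleK.exists_eq_leftHom (h : IsIrreducibleK T K)
    {Q : Matrix (Fin d × Fin dB) (Fin d × Fin dB) ℂ}
    (hQ : ∀ u ∈ T, Commute (leg13Hom (Fin d) (Fin d) (Fin dB) Q)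
      (leg23Hom (Fin d) (Fin d) (Fin dB) (K u))) :
    ∃ E : Matrix (Fin d) (Fin d) ℂ, Q = leftHom (Fin d) (Fin dB) E := by
  have := fun i j => h.exists_eq_smul_one (Q := block Q i j) fun u hu => by
    ext p q
    rw [← leg13Hom_mul_leg23Hom_apply, ← leg23Hom_mul_leg13Hom_apply, hQ u hu]
  choose c hc using this
  refine ⟨Matrix.of c, ?_⟩
  ext ⟨i, b⟩ ⟨j, b'⟩
  have := congrFun (congrFun (hc i j) b) b'
  simpa [block, leftHom_apply] using this

end Blocks

/-! ### Orthonormal bases of complex bilinear forms -/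

section OrthonormalBases

variable {V : Type*} [AddCommGroup V] [Module ℂ V] {ι : Type*} [Fintype ι] [DecidableEq ι]

/-- A basis with `B (e a) (e b) = δ_{ab}`. -/
def IsOrthonormalBasis (B : LinearMap.BilinForm ℂ V) (e : Module.Basis ι ℂ V) : Prop :=
  ∀ a b, B (e a) (e b) = if a = b then 1 else 0

variable {B : LinearMap.BilinForm ℂ V} {e : Module.Basis ι ℂ V}

theorem IsOrthonormalBasis.toMatrix_eq_one (h : IsOrthonormalBasis B e) :
    LinearMap.BilinForm.toMatrix e B = 1 := by
  ext a b
  rw [LinearMap.BilinForm.toMatrix_apply, h a b, Matrix.one_apply]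

theorem IsOrthonormalBasis.repr_apply (h : IsOrthonormalBasis B e) (x : V) (a : ι) :
    e.repr x a = B (e a) x := by
  conv_rhs => rw [← e.sum_repr x, map_sum]
  simp [-Module.Basis.sum_repr, h a]

theorem IsOrthonormalBasis.sum_smul (h : IsOrthonormalBasis B e) (x : V) :
    ∑ a, B (e a) x • e a = x := by
  simp_rw [← h.repr_apply]
  exact e.sum_repr x

theorem IsOrthonormalBasis.casimirTensor_eq [FiniteDimensional ℂ V] {m n : Type*}
    (h : IsOrthonormalBasis B e) (φ : V →ₗ[ℂ] Matrix m m ℂ) (ψ : V →ₗ[ℂ] Matrix n n ℂ) :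
    casimirTensor B φ ψ = ∑ a, φ (e a) ⊗ₖ ψ (e a) := by
  rw [KMat.casimirTensor_eq B φ ψ e, h.toMatrix_eq_one]
  simp [Matrix.one_apply, ite_smul]

theorem IsOrthonormalBasis.casimir_eq [FiniteDimensional ℂ V] {m : Type*} [Fintype m]
    [DecidableEq m] (h : IsOrthonormalBasis B e) (φ : V →ₗ[ℂ] Matrix m m ℂ) :
    casimir B φ = ∑ a, φ (e a) * φ (e a) := by
  rw [KMat.casimir_eq B φ e, h.toMatrix_eq_one]
  simp [Matrix.one_apply, ite_smul]

/-- The form is bilinear, not Hermitian, and ℂ has square roots: an orthogonal basis can be rescaled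
to norm 1. -/
theorem exists_isOrthonormalBasis [FiniteDimensional ℂ V] (hs : LinearMap.IsSymm B) (hn : B.Nondegenerate) :
    ∃ e : Module.Basis (Fin (Module.finrank ℂ V)) ℂ V, IsOrthonormalBasis B e := by
  have : Invertible (2 : ℂ) := invertibleOfNonzero two_ne_zero
  obtain ⟨v, hv⟩ := LinearMap.BilinForm.exists_orthogonal_basis hs
  have hne : ∀ i, B (v i) (v i) ≠ 0 :=
    LinearMap.BilinForm.iIsOrtho.not_isOrtho_basis_self_of_nondegenerate hv hn
  choose c hc using fun i => IsAlgClosed.exists_pow_nat_eq (B (v i) (v i)) zero_lt_two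
  have hc0 : ∀ i, c i ≠ 0 := fun i h => hne i (by rw [← hc i, h]; simp)
  refine ⟨v.isUnitSMul (w := fun i => (c i)⁻¹) fun i => (inv_ne_zero (hc0 i)).isUnit,
    fun a b => ?_⟩
  simp only [Module.Basis.isUnitSMul_apply, map_smul, LinearMap.smul_apply, smul_eq_mul]
  split_ifs with h
  · subst h
    rw [← hc a]
    field_simp [hc0 a]
  · rw [show B (v a) (v b) = 0 from hv h]; simp

/-- By `h0` each vector Σ P(e_a)_ij e_a lies in ker M, and its pairing with x is the entry P(x)_ij.
So (ker M)^⊥ ⊆ ker P; by `hinj` this meets ker M trivially, hence is a complement. -/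
theorem isCompl_ker_of_sum_eq_zero [FiniteDimensional ℂ V] {n : Type*} (hs : LinearMap.IsSymm B)
    (h : IsOrthonormalBasis B e) (P M : V →ₗ[ℂ] Matrix n n ℂ)
    (h0 : ∀ i j, ∑ a, P (e a) i j • M (e a) = 0)
    (hinj : ∀ x, P x = 0 → M x = 0 → x = 0) (x : V) :
    ∃ y z, M y = 0 ∧ P z = 0 ∧ x = y + z := by
  have hle : B.orthogonal (LinearMap.ker M) ≤ LinearMap.ker P := by
    intro x hx
    ext i j
    have hw : ∑ a, P (e a) i j • e a ∈ LinearMap.ker M := by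
      rw [LinearMap.mem_ker, map_sum]
      simpa using h0 i j
    have : B (∑ a, P (e a) i j • e a) x = 0 := hx _ hw
    rw [← h.sum_smul x]
    simp only [map_sum, map_smul, LinearMap.sum_apply, LinearMap.smul_apply, smul_eq_mul] at this
    simp only [map_sum, map_smul, Matrix.sum_apply, Matrix.smul_apply, smul_eq_mul,
      Matrix.zero_apply]
    rw [← this]
    exact Finset.sum_congr rfl fun a _ => mul_comm _ _
  have hdisj : Disjoint (LinearMap.ker M) (B.orthogonal (LinearMap.ker M)) := by
    rw [Submodule.disjoint_def]
    exact fun x hx hx' => hinj x (hle hx') hx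
  have hcompl := (LinearMap.BilinForm.isCompl_orthogonal_iff_disjoint hs.isRefl).mpr hdisj
  obtain ⟨y, z, hy, hz, hyz⟩ := Submodule.codisjoint_iff_exists_add_eq.mp hcompl.codisjoint x
  exact ⟨y, z, hy, hle hz, hyz.symm⟩

end OrthonormalBases

/-! ### Invariance of Casimir elements -/

section Invariance

variable {𝔨 A : Type*} [LieRing 𝔨] [LieAlgebra ℂ 𝔨] [Ring A] [Algebra ℂ A]
  {ι : Type*} [Fintype ι] [DecidableEq ι]
  {B : LinearMap.BilinForm ℂ 𝔨} {e : Module.Basis ι ℂ 𝔨}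

/-- Invariance of B makes ad x antisymmetric in an orthonormal basis, so the two sums cancel after
exchanging indices. -/
theorem IsOrthonormalBasis.sum_lie_add {W : Type*} [AddCommGroup W] [Module ℂ W]
    (h : IsOrthonormalBasis B e) (hB : ∀ x y z : 𝔨, B ⁅x, y⁆ z = -B y ⁅x, z⁆)
    (F : 𝔨 →ₗ[ℂ] 𝔨 →ₗ[ℂ] W) (x : 𝔨) :
    ∑ a, (F ⁅x, e a⁆ (e a) + F (e a) ⁅x, e a⁆) = 0 := by
  -- Symmetry of B need not be assumed: it follows from the orthonormal basis.
  have hflip : B = LinearMap.flip B := LinearMap.ext_basis e e fun a b => by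
    rw [LinearMap.flip_apply, h a b, h b a]
    simp only [eq_comm]
  have hs : ∀ y z, B y z = B z y := fun y z => LinearMap.congr_fun₂ hflip y z
  rw [Finset.sum_add_distrib]
  have h1 : ∀ a, F ⁅x, e a⁆ (e a) = ∑ b, B (e b) ⁅x, e a⁆ • F (e b) (e a) := fun a => by
    conv_lhs => rw [← h.sum_smul ⁅x, e a⁆]
    simp
  have h2 : ∀ a, F (e a) ⁅x, e a⁆ = ∑ b, B (e b) ⁅x, e a⁆ • F (e a) (e b) := fun a => by
    conv_lhs => rw [← h.sum_smul ⁅x, e a⁆]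
    simp
  simp_rw [h1, h2]
  rw [Finset.sum_comm, ← Finset.sum_add_distrib]
  refine Finset.sum_eq_zero fun b _ => ?_
  rw [← Finset.sum_add_distrib]
  refine Finset.sum_eq_zero fun a _ => ?_
  rw [← add_smul, hs (e a) ⁅x, e b⁆, hB x (e b) (e a)]
  simp

/-- Stated for arbitrary f and g so as to cover both the Casimir element and the split Casimir in
two different legs. -/
theorem IsOrthonormalBasis.commute_sum_mul (h : IsOrthonormalBasis B e)
    (hB : ∀ x y z : 𝔨, B ⁅x, y⁆ z = -B y ⁅x, z⁆) (f g : 𝔨 →ₗ[ℂ] A) (x : 𝔨) {X : A}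
    (hf : ∀ y, X * f y - f y * X = f ⁅x, y⁆) (hg : ∀ y, X * g y - g y * X = g ⁅x, y⁆) :
    Commute X (∑ a, f (e a) * g (e a)) := by
  have := h.sum_lie_add hB ((LinearMap.mul ℂ A).compl₁₂ f g) x
  rw [commute_iff_eq, ← sub_eq_zero, Finset.mul_sum, Finset.sum_mul, ← Finset.sum_sub_distrib,
    ← this]
  refine Finset.sum_congr rfl fun a _ => ?_
  simp only [LinearMap.compl₁₂_apply, LinearMap.mul_apply', ← hf, ← hg]
  noncomm_ring

end Invariance

/-! ### The second order commutator identity -/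

section CommutatorIdentity

variable {A : Type*} [NormedRing A] [NormedAlgebra ℂ A]

/-- H and M stand for the parts of the split Casimir in legs 1, 2 along 𝔥 and along its complement,
X and Y for the 𝔥-Casimirs of legs 1, 3 and 2, 3, and c₁, c₂ for the one-leg 𝔥-Casimirs. The factor
2 before X and Y is exactly what cancels the [H, X] terms. By `hc`, [H, M] = ½[M, c₁ + c₂], which is
the origin of the term ½ c^(𝔥). -/
theorem commutatorSum_eq {H M X Y E₁ E₂ c₁ c₂ : A}
    (hX : Commute H (X + Y)) (hX' : Commute M (X + Y)) (hXY : X * Y - Y * X = H * X - X * H)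
    (hE₁ : Commute H E₁) (hE₂ : Commute H E₂) (h₁ : Commute E₁ Y) (h₂ : Commute X E₂)
    (h₁₂ : Commute E₁ E₂) (hc : Commute M ((2 : ℂ) • H + (c₁ + c₂)))
    {c : ℂ} (hc0 : c ≠ 0) (hc1 : c + 1 ≠ 0) (hc2 : c - 1 ≠ 0) :
    commutatorSum c (H + M) (H - M) (E₁ + (2 : ℂ) • X) (E₂ + (2 : ℂ) • Y) =
      (2 / c) • (M * (E₁ + E₂ - (1 / 2 : ℂ) • (c₁ + c₂))
        - (E₁ + E₂ - (1 / 2 : ℂ) • (c₁ + c₂)) * M) := by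
  have i1 : H * Y = (X + Y) * H - H * X := by rw [← hX.eq]; noncomm_ring
  have i2 : M * Y = (X + Y) * M - M * X := by rw [← hX'.eq]; noncomm_ring
  have i3 : X * Y = Y * X + H * X - X * H := by
    rw [sub_eq_iff_eq_add'.mp hXY]; abel
  have i4 : M * (c₁ + c₂) = ((2 : ℂ) • H + (c₁ + c₂)) * M - (2 : ℂ) • (M * H) := by
    rw [← hc.eq, mul_add M (_ • H), mul_smul_comm, add_sub_cancel_left]
  have a1 : (H + M) * (E₁ + (2 : ℂ) • X) - (E₁ + (2 : ℂ) • X) * (H + M) =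
      (M * E₁ - E₁ * M) + (2 : ℂ) • (H * X - X * H) + (2 : ℂ) • (M * X - X * M) := by
    simp only [mul_add, add_mul, mul_smul_comm, smul_mul_assoc, hE₁.eq]
    module
  have a2 : (H + M) * (H - M) - (H - M) * (H + M) = (-2 : ℂ) • (H * M - M * H) := by
    simp only [mul_add, add_mul, mul_sub, sub_mul]
    module
  have a3 : (H + M) * (E₂ + (2 : ℂ) • Y) - (E₂ + (2 : ℂ) • Y) * (H + M) =
      (M * E₂ - E₂ * M) - (2 : ℂ) • (H * X - X * H) - (2 : ℂ) • (M * X - X * M) := by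
    simp only [mul_add, add_mul, mul_smul_comm, smul_mul_assoc, hE₂.eq, i1, i2]
    module
  have a4 : (E₁ + (2 : ℂ) • X) * (H - M) - (H - M) * (E₁ + (2 : ℂ) • X) =
      (M * E₁ - E₁ * M) - (2 : ℂ) • (H * X - X * H) + (2 : ℂ) • (M * X - X * M) := by
    simp only [mul_add, add_mul, mul_sub, sub_mul, mul_smul_comm, smul_mul_assoc, hE₁.eq]
    module
  have a5 : (E₁ + (2 : ℂ) • X) * (E₂ + (2 : ℂ) • Y) - (E₂ + (2 : ℂ) • Y) * (E₁ + (2 : ℂ) • X) =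
      (4 : ℂ) • (H * X - X * H) := by
    simp only [mul_add, add_mul, mul_smul_comm, smul_mul_assoc, h₁.eq, h₂.eq, h₁₂.eq, i3]
    module
  have a6 : (H - M) * (E₂ + (2 : ℂ) • Y) - (E₂ + (2 : ℂ) • Y) * (H - M) =
      (2 : ℂ) • (M * X - X * M) - (2 : ℂ) • (H * X - X * H) - (M * E₂ - E₂ * M) := by
    simp only [mul_add, add_mul, mul_sub, sub_mul, mul_smul_comm, smul_mul_assoc, hE₂.eq, i1, i2]
    module
  have a7 : M * (E₁ + E₂ - (1 / 2 : ℂ) • (c₁ + c₂)) - (E₁ + E₂ - (1 / 2 : ℂ) • (c₁ + c₂)) * M =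
      (M * E₁ - E₁ * M) + (M * E₂ - E₂ * M) - (H * M - M * H) := by
    rw [mul_sub, mul_smul_comm, i4]
    simp only [mul_add, add_mul, sub_mul, smul_add, smul_sub, smul_mul_assoc]
    module
  rw [commutatorSum, a1, a2, a3, a4, a5, a6, a7]
  generalize M * E₁ - E₁ * M = V₁
  generalize M * E₂ - E₂ * M = V₂
  generalize H * X - X * H = U
  generalize M * X - X * M = T
  generalize H * M - M * H = W
  match_scalars <;> field_simp <;> ring

end CommutatorIdentity

/-! ### Contracting a tensor leg with a functional -/

section Functionals

variable {d : ℕ} {W ι : Type*} [AddCommGroup W] [Module ℂ W] [Fintype ι]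

theorem linearMap_apply_eq_sum (f : Matrix (Fin d) (Fin d) ℂ →ₗ[ℂ] ℂ)
    (A : Matrix (Fin d) (Fin d) ℂ) :
    f A = ∑ i, ∑ j, f (Matrix.single i j 1) * A i j := by
  conv_lhs => rw [Matrix.matrix_eq_sum_single A]
  simp only [map_sum]
  refine Finset.sum_congr rfl fun i _ => Finset.sum_congr rfl fun j _ => ?_
  rw [← mul_one (A i j), ← smul_eq_mul, ← Matrix.smul_single, map_smul, smul_eq_mul, smul_eq_mul,
    mul_one, mul_comm]

/-- Tensor relations are available entry by entry in one leg; this passes from entries to an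
arbitrary functional on that leg. -/
theorem sum_functional_smul (f : Matrix (Fin d) (Fin d) ℂ →ₗ[ℂ] ℂ)
    (A : ι → Matrix (Fin d) (Fin d) ℂ) (w : ι → W) :
    ∑ a, f (A a) • w a =
      ∑ i, ∑ j, f (Matrix.single i j 1) • ∑ a, A a i j • w a := by
  simp_rw [linearMap_apply_eq_sum f (A _), Finset.sum_smul, Finset.smul_sum, smul_smul]
  rw [Finset.sum_comm]
  refine Finset.sum_congr rfl fun i _ => ?_
  rw [Finset.sum_comm]

/-- Linear functionals that are dual to the image of a basis under an injective map. -/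
theorem exists_dual_functional {V : Type*} [AddCommGroup V] [Module ℂ V] [DecidableEq ι]
    (e : Module.Basis ι ℂ V) (φ : V →ₗ[ℂ] Matrix (Fin d) (Fin d) ℂ)
    (hφ : Function.Injective φ) :
    ∃ f : ι → Matrix (Fin d) (Fin d) ℂ →ₗ[ℂ] ℂ, ∀ a b, f a (φ (e b)) = if a = b then 1 else 0 := by
  obtain ⟨g, hg⟩ := φ.exists_leftInverse_of_injective (LinearMap.ker_eq_bot.mpr hφ)
  refine ⟨fun a => (e.coord a).comp g, fun a b => ?_⟩
  have : g (φ (e b)) = e b := LinearMap.congr_fun hg (e b)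
  simp [this, Finsupp.single_apply, eq_comm]

end Functionals

/-! ### Involutions, adapted bases and inner derivations -/

section Involutions

variable {𝔤 : Type*} [LieRing 𝔤] [LieAlgebra ℂ 𝔤] {d : ℕ}

/-- Since σ = ρ on one summand and σ = −ρ on the other, σ takes values in the image of ρ, and α =
ρ⁻¹σ. -/
theorem exists_involution (ρ : 𝔤 →ₗ⁅ℂ⁆ Matrix (Fin d) (Fin d) ℂ) (hρ : Function.Injective ρ)
    (σ : 𝔤 →ₗ⁅ℂ⁆ Matrix (Fin d) (Fin d) ℂ)
    (h : ∀ x, ∃ y z, ρ y - σ y = 0 ∧ ρ z + σ z = 0 ∧ x = y + z) :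
    ∃ α : 𝔤 →ₗ⁅ℂ⁆ 𝔤, (∀ x, α (α x) = x) ∧ ∀ x, ρ (α x) = σ x := by
  obtain ⟨g, hg⟩ := (ρ : 𝔤 →ₗ[ℂ] Matrix (Fin d) (Fin d) ℂ).exists_leftInverse_of_injective
    (LinearMap.ker_eq_bot.mpr hρ)
  have hg' : ∀ x, g (ρ x) = x := fun x => LinearMap.congr_fun hg x
  have hα : ∀ x, ρ (g (σ x)) = σ x := fun x => by
    obtain ⟨y, z, hy, hz, rfl⟩ := h x
    have : σ (y + z) = ρ (y - z) := by
      rw [map_add, map_sub, ← sub_eq_zero.mp hy, eq_neg_of_add_eq_zero_right hz, sub_eq_add_neg]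
    rw [this, hg']
  refine ⟨{ g ∘ₗ (σ : 𝔤 →ₗ[ℂ] Matrix (Fin d) (Fin d) ℂ) with
    map_lie' := fun {x y} => hρ ?_ }, fun x => ?_, hα⟩
  · change ρ (g (σ ⁅x, y⁆)) = ρ ⁅g (σ x), g (σ y)⁆
    rw [hα, LieHom.map_lie, LieHom.map_lie, hα, hα]
  · change g (σ (g (σ x))) = x
    obtain ⟨y, z, hy, hz, rfl⟩ := h x
    have hσy : σ y = ρ y := (sub_eq_zero.mp hy).symm
    have hσz : σ z = -ρ z := eq_neg_of_add_eq_zero_right hz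
    simp [hσy, hσz, hg']

theorem killingForm_lie (x y z : 𝔤) : killingForm ℂ 𝔤 ⁅x, y⁆ z = -killingForm ℂ 𝔤 y ⁅x, z⁆ :=
  LieModule.traceForm_apply_lie_apply' ℂ 𝔤 𝔤 x y z

variable [FiniteDimensional ℂ 𝔤] [LieAlgebra.IsKilling ℂ 𝔤]

theorem killingForm_involution (α : 𝔤 →ₗ⁅ℂ⁆ 𝔤) (hα : ∀ x, α (α x) = x) (x y : 𝔤) :
    killingForm ℂ 𝔤 (α x) (α y) = killingForm ℂ 𝔤 x y :=
  LieAlgebra.killingForm_of_equiv_apply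
    ({ α with invFun := α, left_inv := hα, right_inv := hα } : 𝔤 ≃ₗ⁅ℂ⁆ 𝔤) x y

/-- An orthonormal basis of the Lie algebra that consists of eigenvectors of an involution. -/
theorem exists_adapted_basis (α : 𝔤 →ₗ⁅ℂ⁆ 𝔤) (hα : ∀ x, α (α x) = x) :
    ∃ (p q : ℕ) (e : Module.Basis (Fin p) ℂ (fixedSubalgebra α))
      (b : Module.Basis (Fin p ⊕ Fin q) ℂ 𝔤),
      IsOrthonormalBasis (killingOn (fixedSubalgebra α)) e ∧
      IsOrthonormalBasis (killingForm ℂ 𝔤) b ∧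
      (∀ a, b (Sum.inl a) = e a) ∧ ∀ a, α (b (Sum.inr a)) = -b (Sum.inr a) := by
  set B := killingForm ℂ 𝔤
  have hs : LinearMap.IsSymm B := LieModule.traceForm_isSymm ℂ 𝔤 𝔤
  have hc : ∀ x y, B x y = B y x := LieModule.traceForm_comm ℂ 𝔤 𝔤
  have hn : B.Nondegenerate := LieAlgebra.IsKilling.killingForm_nondegenerate ℂ 𝔤
  set W := (fixedSubalgebra α).toSubmodule
  have hmem : ∀ x, x ∈ W ↔ α x = x := fun x => Iff.rfl
  -- Invariance of B gives B(x + αx, y) = B(x, y + αy), which vanishes because y + αy is fixed.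
  have hneg : ∀ x ∈ B.orthogonal W, α x = -x := fun x hx => by
    have h0 : ∀ y, B (x + α x) y = 0 := fun y => by
      have h1 : y + α y ∈ W := by rw [hmem, map_add, hα, add_comm]
      have h2 : B (y + α y) x = 0 := hx _ h1
      rw [map_add, LinearMap.add_apply, ← killingForm_involution α hα (α y) x, hα] at h2
      rw [map_add, LinearMap.add_apply, hc x y, hc (α x) y]
      exact h2
    exact eq_neg_of_add_eq_zero_right (hn.1 _ h0)
  have hdisj : Disjoint W (B.orthogonal W) := by
    rw [Submodule.disjoint_def]
    intro x hx hx'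
    have h1 := hneg x hx'
    rw [(hmem x).mp hx] at h1
    have h2 : (2 : ℂ) • x = 0 := by rw [two_smul]; nth_rewrite 1 [h1]; exact neg_add_cancel x
    exact (smul_eq_zero.mp h2).resolve_left two_ne_zero
  have hcompl := (LinearMap.BilinForm.isCompl_orthogonal_iff_disjoint hs.isRefl).mpr hdisj
  have hsymm : ∀ U : Submodule ℂ 𝔤, LinearMap.IsSymm (B.restrict U) := fun U =>
    ⟨fun x y => hc x y⟩
  have hdisj' : Disjoint (B.orthogonal W) (B.orthogonal (B.orthogonal W)) := by
    rw [LinearMap.BilinForm.orthogonal_orthogonal hn hs.isRefl]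
    exact hdisj.symm
  obtain ⟨e, he⟩ := exists_isOrthonormalBasis (hsymm W)
    (LinearMap.BilinForm.nondegenerate_restrict_of_disjoint_orthogonal B hs.isRefl hdisj)
  obtain ⟨f, hf⟩ := exists_isOrthonormalBasis (hsymm (B.orthogonal W))
    (LinearMap.BilinForm.nondegenerate_restrict_of_disjoint_orthogonal B hs.isRefl hdisj')
  have hl : ∀ a, ((e.prod f).map (Submodule.prodEquivOfIsCompl _ _ hcompl)) (Sum.inl a) = e a :=
    fun a => by simp
  have hr : ∀ a, ((e.prod f).map (Submodule.prodEquivOfIsCompl _ _ hcompl)) (Sum.inr a) = f a :=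
    fun a => by simp
  refine ⟨_, _, e, (e.prod f).map (Submodule.prodEquivOfIsCompl _ _ hcompl), he, ?_, hl,
    fun a => ?_⟩
  · rintro (a | a) (c | c)
    · rw [hl, hl]; simpa using he a c
    · rw [hl, hr]; simpa using (f c).2 _ (e a).2
    · rw [hl, hr, hc]; simpa using (f a).2 _ (e c).2
    · rw [hr, hr]; simpa using hf a c
  · rw [hr]; exact hneg _ (f a).2

variable {p q : ℕ} {α : 𝔤 →ₗ⁅ℂ⁆ 𝔤} {b : Module.Basis (Fin p ⊕ Fin q) ℂ 𝔤}

/-- A derivation of the Lie algebra, implemented by a matrix that satisfies a classical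
reflection-type equation, comes from the centre of the fixed subalgebra. -/
theorem exists_central_shift (ρ : 𝔤 →ₗ⁅ℂ⁆ Matrix (Fin d) (Fin d) ℂ) (hρ : Function.Injective ρ)
    (hl : ∀ a, α (b (Sum.inl a)) = b (Sum.inl a)) (hr : ∀ a, α (b (Sum.inr a)) = -b (Sum.inr a))
    (F : Matrix (Fin d) (Fin d) ℂ)
    (hF : ∀ a, Commute (ρ (b (Sum.inl a))) F)
    (h0 : ∑ a, ((ρ (b (Sum.inr a)) * F - F * ρ (b (Sum.inr a))) ⊗ₖ ρ (b (Sum.inr a))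
      + ρ (b (Sum.inr a)) ⊗ₖ (ρ (b (Sum.inr a)) * F - F * ρ (b (Sum.inr a)))) = 0) :
    ∃ z : 𝔤, α z = z ∧ (∀ x, α x = x → ⁅z, x⁆ = 0) ∧
      ∀ x, (F + ρ z) * ρ x = ρ x * (F + ρ z) := by
  obtain ⟨f, hf⟩ := exists_dual_functional b (ρ : 𝔤 →ₗ[ℂ] Matrix (Fin d) (Fin d) ℂ) hρ
  set N : Fin q → Matrix (Fin d) (Fin d) ℂ := fun a =>
    ρ (b (Sum.inr a)) * F - F * ρ (b (Sum.inr a))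
  -- The functional dual to the c-th basis vector, applied to the first tensor factor of `h0`, gives
  -- Σ f_c(N_a) ρ(X_a) + N_c = 0. So [ρ(X_c), F] lies in ρ of the −1 eigenspace.
  have key : ∀ c, N c = ρ (-∑ a, f (Sum.inr c) (N a) • b (Sum.inr a)) := fun c => by
    have h1 : ∀ i j, ∑ a, N a i j • ρ (b (Sum.inr a)) + ∑ a, ρ (b (Sum.inr a)) i j • N a = 0 := by
      intro i j
      ext k l
      have := congrFun (congrFun h0 (i, k)) (j, l)
      simp only [Matrix.sum_apply, Matrix.add_apply, Matrix.kroneckerMap_apply,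
        Matrix.zero_apply, Matrix.smul_apply, smul_eq_mul, Finset.sum_add_distrib] at this ⊢
      exact this
    have h2 := sum_functional_smul (f (Sum.inr c)) N (fun a => ρ (b (Sum.inr a)))
    have h3 := sum_functional_smul (f (Sum.inr c)) (fun a => ρ (b (Sum.inr a))) N
    have h4 : ∑ a, f (Sum.inr c) (ρ (b (Sum.inr a))) • N a = N c := by
      have : ∀ a, f (Sum.inr c) (ρ (b (Sum.inr a))) = if c = a then 1 else 0 := fun a => by
        simpa using hf (Sum.inr c) (Sum.inr a)
      simp [this]
    have h5 : ∑ a, f (Sum.inr c) (N a) • ρ (b (Sum.inr a)) + N c = 0 := by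
      rw [h2, ← h4, h3, ← Finset.sum_add_distrib]
      refine Finset.sum_eq_zero fun i _ => ?_
      rw [← Finset.sum_add_distrib]
      refine Finset.sum_eq_zero fun j _ => ?_
      rw [← smul_add, h1, smul_zero]
    rw [map_neg, map_sum]
    simp only [map_smul]
    exact eq_neg_of_add_eq_zero_right h5
  let δ : 𝔤 →ₗ[ℂ] 𝔤 := b.constr ℂ
    (Sum.elim (fun _ => 0) fun c => -∑ a, f (Sum.inr c) (N a) • b (Sum.inr a))
  have hδl : ∀ a, δ (b (Sum.inl a)) = 0 := fun a => by simp [δ]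
  have hδr : ∀ c, δ (b (Sum.inr c)) = -∑ a, f (Sum.inr c) (N a) • b (Sum.inr a) := fun c => by
    simp [δ]
  have hδ : ∀ x, ρ (δ x) = ρ x * F - F * ρ x := by
    have : (ρ : 𝔤 →ₗ[ℂ] Matrix (Fin d) (Fin d) ℂ) ∘ₗ δ =
        (LinearMap.mulRight ℂ F - LinearMap.mulLeft ℂ F) ∘ₗ
          (ρ : 𝔤 →ₗ[ℂ] Matrix (Fin d) (Fin d) ℂ) := by
      refine b.ext fun i => ?_
      rcases i with a | c
      · simp [hδl, (hF a).eq]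
      · simpa [hδr] using (key c).symm
    exact fun x => LinearMap.congr_fun this x
  have hδα : ∀ x, δ (α x) = α (δ x) := by
    have : δ ∘ₗ (α : 𝔤 →ₗ[ℂ] 𝔤) = (α : 𝔤 →ₗ[ℂ] 𝔤) ∘ₗ δ := by
      refine b.ext fun i => ?_
      rcases i with a | c
      · simp [hl, hδl]
      · simp [hr, hδr]
    exact fun x => LinearMap.congr_fun this x
  -- After applying ρ, δ is a commutator with F; faithfulness pulls the Leibniz rule back to 𝔤,
  -- where derivations are inner.
  let Dv : LieDerivation ℂ 𝔤 𝔤 :=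
    { δ with
      leibniz' := fun x y => hρ (by
        change ρ (δ ⁅x, y⁆) = ρ (⁅x, δ y⁆ - ⁅y, δ x⁆)
        rw [map_sub, LieHom.map_lie, LieHom.map_lie, hδ, hδ, hδ, LieHom.map_lie]
        simp only [Ring.lie_def]
        noncomm_ring) }
  obtain ⟨z, hz⟩ := LieDerivation.IsKilling.exists_eq_ad Dv
  have hz' : ∀ x, ⁅z, x⁆ = δ x := fun x => by
    have := LieDerivation.congr_fun hz x
    rwa [LieDerivation.ad_apply_apply] at this
  have hδ0 : ∀ x, α x = x → δ x = 0 := by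
    have : δ ∘ₗ (LinearMap.id + (α : 𝔤 →ₗ[ℂ] 𝔤)) = 0 := by
      refine b.ext fun i => ?_
      rcases i with a | c
      · simp [hl, hδl]
      · simp [hr]
    intro x hx
    have h1 : δ (x + α x) = 0 := LinearMap.congr_fun this x
    rw [hx, ← two_smul ℂ x, map_smul] at h1
    exact (smul_eq_zero.mp h1).resolve_left two_ne_zero
  have hα : ∀ x, α (α x) = x := by
    have : (α : 𝔤 →ₗ[ℂ] 𝔤) ∘ₗ (α : 𝔤 →ₗ[ℂ] 𝔤) = LinearMap.id := by
      refine b.ext fun i => ?_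
      rcases i with a | c
      · simp [hl]
      · simp [hr]
    exact fun x => LinearMap.congr_fun this x
  refine ⟨z, ?_, fun x hx => (hz' x).trans (hδ0 x hx), fun x => ?_⟩
  -- δ commutes with α, so ad(αz) = ad z, and the adjoint representation is faithful.
  · rw [← sub_eq_zero, ← LieDerivation.IsKilling.ad_apply_eq_zero_iff ℂ 𝔤]
    ext x
    rw [LieDerivation.ad_apply_apply, sub_lie, hz', ← hα x, ← LieHom.map_lie, hz', hδα]
    simp [hα]
  · have := hδ x
    rw [← hz', LieHom.map_lie, Ring.lie_def] at this
    rw [add_mul, mul_add, ← sub_eq_zero]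
    rw [← sub_eq_zero] at this
    rw [← this]
    noncomm_ring

end Involutions

/-! ### From entrywise bounds to matrix expansions -/

section MatrixExpansion

open scoped Matrix.Norms.Operator

variable {p q : Type*} [Fintype p] [DecidableEq p] [Fintype q] [DecidableEq q]

theorem hasExpansion_of_isBigOInv {K : ℂ → Matrix p p ℂ} {A₀ A₁ : Matrix p p ℂ}
    (h : IsBigOInv (fun u => K u - (A₀ + u⁻¹ • A₁)) 2) :
    HasExpansion (cobounded ℂ) (fun u => u⁻¹) K A₀ A₁ := by
  have h0 : ∀ i j, (fun u => (K u - (A₀ + u⁻¹ • A₁)) i j •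
      (Matrix.single i j (1 : ℂ) : Matrix p p ℂ)) =O[cobounded ℂ] fun u => u⁻¹ ^ 2 := fun i j => by
    have h2 := (h i j).smul (isBigO_const_const (Matrix.single i j (1 : ℂ) : Matrix p p ℂ)
      (one_ne_zero (α := ℂ)) (cobounded ℂ))
    simpa using h2
  have h1 := IsBigO.sum (s := Finset.univ) fun i _ =>
    IsBigO.sum (s := Finset.univ) fun j _ => h0 i j
  refine h1.congr_left fun u => ?_
  conv_rhs => rw [Matrix.matrix_eq_sum_single (K u - (A₀ + u⁻¹ • A₁))]
  simp [Matrix.smul_single]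

theorem HasExpansion.map {f : ℂ → Matrix p p ℂ} {A₀ A₁ : Matrix p p ℂ} {l : Filter ℂ} {s : ℂ → ℂ}
    (h : HasExpansion l s f A₀ A₁) (φ : Matrix p p ℂ →ₗ[ℂ] Matrix q q ℂ) :
    HasExpansion l s (fun t => φ (f t)) (φ A₀) (φ A₁) := by
  have h1 := (ContinuousLinearMap.isBigO_comp (LinearMap.toContinuousLinearMap φ)
    (fun t => f t - (A₀ + s t • A₁)) l).trans h
  refine h1.congr_left fun t => ?_
  simp

/-- A linear relation obeyed by K at all regular points passes to both coefficients, by their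
uniqueness. -/
theorem HasExpansion.linear_relation {K : ℂ → Matrix p p ℂ} {A₀ A₁ : Matrix p p ℂ} {T : Set ℂ}
    (hT : T ∈ cobounded ℂ) (h : HasExpansion (cobounded ℂ) (fun u => u⁻¹) K A₀ A₁)
    (φ : Matrix p p ℂ →ₗ[ℂ] Matrix q q ℂ) (hφ : ∀ v ∈ T, φ (K v) = 0) :
    φ A₀ = 0 ∧ φ A₁ = 0 := by
  refine (h.map φ).unique tendsto_inv₀_cobounded' ?_
  refine (HasExpansion.const 0).congr ?_
  filter_upwards [hT] with v hv
  rw [hφ v hv]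

end MatrixExpansion

/-! ### The equation at first order in 1/u -/

section FirstOrder

open scoped Matrix.Norms.Operator

variable {𝔤 : Type*} [LieRing 𝔤] [LieAlgebra ℂ 𝔤] {d dB : ℕ}
  {ρ : Fin 2 → 𝔤 →ₗ⁅ℂ⁆ Matrix (Fin d) (Fin d) ℂ}
  {S T : Set ℂ} {R : Fin 2 → Fin 2 → ℂ → Matrix (Fin d × Fin d) (Fin d × Fin d) ℂ}
  {K : ℂ → Matrix (Fin d × Fin dB) (Fin d × Fin dB) ℂ}
  {κ' k₁ : Matrix (Fin d × Fin dB) (Fin d × Fin dB) ℂ}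
  {κ : Matrix (Fin d) (Fin d) ℂ}
  {ι : Type*} [Fintype ι] [DecidableEq ι] {b : Module.Basis ι ℂ 𝔤}

local notation "Λ₁" => leg1 (Fin d) (Fin d) (Fin dB)
local notation "Λ₂" => leg2 (Fin d) (Fin d) (Fin dB)
local notation "Λ₁₂" => leg12Hom (Fin d) (Fin d) (Fin dB)
local notation "Λ₁₃" => leg13Hom (Fin d) (Fin d) (Fin dB)
local notation "Λ₂₃" => leg23Hom (Fin d) (Fin d) (Fin dB)
local notation "λL" => leftHom (Fin d) (Fin dB)
local notation "λR" => rightHom (Fin d) (Fin dB)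

/-- `X ↦ κ ρ(X) κ⁻¹`. -/
def conjHom (κ : Matrix (Fin d) (Fin d) ℂ) (hκ : IsUnit κ)
    (ρ : 𝔤 →ₗ⁅ℂ⁆ Matrix (Fin d) (Fin d) ℂ) : 𝔤 →ₗ⁅ℂ⁆ Matrix (Fin d) (Fin d) ℂ :=
  { LinearMap.mulLeft ℂ κ ∘ₗ LinearMap.mulRight ℂ κ⁻¹ ∘ₗ
      (ρ : 𝔤 →ₗ[ℂ] Matrix (Fin d) (Fin d) ℂ) with
    map_lie' := fun {x y} => by
      have h : κ⁻¹ * κ = 1 :=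
        Matrix.nonsing_inv_mul κ ((Matrix.isUnit_iff_isUnit_det κ).mp hκ)
      have h' : ∀ A B : Matrix (Fin d) (Fin d) ℂ,
          κ * (A * κ⁻¹) * (κ * (B * κ⁻¹)) = κ * (A * B * κ⁻¹) := fun A B => by
        calc _ = κ * (A * (κ⁻¹ * κ) * B * κ⁻¹) := by noncomm_ring
          _ = _ := by rw [h, mul_one]
      change κ * (ρ ⁅x, y⁆ * κ⁻¹) = ⁅κ * (ρ x * κ⁻¹), κ * (ρ y * κ⁻¹)⁆
      rw [LieHom.map_lie, Ring.lie_def, Ring.lie_def, h', h']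
      noncomm_ring }

theorem conjHom_apply (hκ : IsUnit κ) (ρ : 𝔤 →ₗ⁅ℂ⁆ Matrix (Fin d) (Fin d) ℂ) (x : 𝔤) :
    conjHom κ hκ ρ x = κ * ρ x * κ⁻¹ := (mul_assoc _ _ _).symm

theorem isUnit_of_isUnit_leftHom [Nonempty (Fin dB)] (h : IsUnit (λL κ)) : IsUnit κ := by
  rw [Matrix.isUnit_iff_isUnit_det, leftHom_apply, Matrix.det_kronecker, IsUnit.mul_iff] at h
  rw [Matrix.isUnit_iff_isUnit_det]
  exact (isUnit_pow_iff Fintype.card_ne_zero).mp h.1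

/-- `flip21` as a linear map. -/
def flipMap (l : Type*) : Matrix (l × l) (l × l) ℂ →ₗ[ℂ] Matrix (l × l) (l × l) ℂ where
  toFun := flip21
  map_add' _ _ := rfl
  map_smul' _ _ := rfl

theorem flipMap_one : flipMap (Fin d) 1 = 1 := by
  rw [← Matrix.one_kronecker_one]
  exact flip21_kronecker _ _

section

variable [FiniteDimensional ℂ 𝔤]

theorem IsQuasiClassicalR.expansion (hR : IsQuasiClassicalR ρ S R)
    (hb : IsOrthonormalBasis (killingForm ℂ 𝔤) b) (i j : Fin 2) :
    HasExpansion (cobounded ℂ) (fun u => u⁻¹) (fun u => Λ₁₂ (R i j u)) 1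
      (∑ a, Λ₁ (ρ i (b a)) * Λ₂ (ρ j (b a))) := by
  have h := (hasExpansion_of_isBigOInv (hR.asymptotics i j)).map (Λ₁₂).toLinearMap
  rw [hb.casimirTensor_eq] at h
  simpa [leg12Hom_kronecker] using h

theorem IsQuasiClassicalR.expansion_flip (hR : IsQuasiClassicalR ρ S R)
    (hb : IsOrthonormalBasis (killingForm ℂ 𝔤) b) (i j : Fin 2) :
    HasExpansion (cobounded ℂ) (fun u => u⁻¹) (fun u => Λ₁₂ (flip21 (R i j u))) 1
      (∑ a, Λ₁ (ρ j (b a)) * Λ₂ (ρ i (b a))) := by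
  have h := ((hasExpansion_of_isBigOInv (hR.asymptotics i j)).map (flipMap (Fin d))).map
    (Λ₁₂).toLinearMap
  rw [hb.casimirTensor_eq, flipMap_one, map_sum] at h
  have hf : ∀ A B : Matrix (Fin d) (Fin d) ℂ, flipMap (Fin d) (A ⊗ₖ B) = B ⊗ₖ A :=
    flip21_kronecker
  simp only [hf] at h
  have h' : HasExpansion (cobounded ℂ) (fun u => u⁻¹) (fun u => Λ₁₂ (flipMap (Fin d) (R i j u))) 1
      (∑ a, Λ₁ (ρ j (b a)) * Λ₂ (ρ i (b a))) := by simpa [leg12Hom_kronecker] using h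
  exact h'

theorem IsKMatrix.reflection {𝔥₀ : LieSubalgebra ℂ 𝔤} (hK : IsKMatrix ρ S R 𝔥₀ T K) :
    ∀ u ∈ T, ∀ v ∈ T, u - v ∈ S → u + v ∈ S →
      Λ₁₂ (R 0 0 (u - v)) * Λ₁₃ (K u) * Λ₁₂ (flip21 (R 0 1 (u + v))) * Λ₂₃ (K v) =
        Λ₂₃ (K v) * Λ₁₂ (R 0 1 (u + v)) * Λ₁₃ (K u) * Λ₁₂ (flip21 (R 1 1 (u - v))) :=
  hK.boundaryYangBaxter

theorem IsKMatrix.first_order {𝔥₀ : LieSubalgebra ℂ 𝔤} (hR : IsQuasiClassicalR ρ S R)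
    (hK : IsKMatrix ρ S R 𝔥₀ T K) (hb : IsOrthonormalBasis (killingForm ℂ 𝔤) b)
    (hexp : HasExpansion (cobounded ℂ) (fun u => u⁻¹) K κ' k₁) {v : ℂ} (hv : v ∈ T) :
    Commute (Λ₁₃ κ') (Λ₂₃ (K v)) ∧
      (∑ a, Λ₁ (ρ 0 (b a)) * Λ₂ (ρ 0 (b a))) * Λ₁₃ κ' * Λ₂₃ (K v) + Λ₁₃ k₁ * Λ₂₃ (K v)
        + Λ₁₃ κ' * (∑ a, Λ₁ (ρ 1 (b a)) * Λ₂ (ρ 0 (b a))) * Λ₂₃ (K v) =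
      Λ₂₃ (K v) * (∑ a, Λ₁ (ρ 0 (b a)) * Λ₂ (ρ 1 (b a))) * Λ₁₃ κ' + Λ₂₃ (K v) * Λ₁₃ k₁
        + Λ₂₃ (K v) * Λ₁₃ κ' * (∑ a, Λ₁ (ρ 1 (b a)) * Λ₂ (ρ 1 (b a))) :=
  reflection_first_order hR.regular hK.regular (hR.expansion hb 0 0) (hR.expansion_flip hb 0 1)
    (hR.expansion hb 0 1) (hR.expansion_flip hb 1 1) (hexp.map (Λ₁₃).toLinearMap) hK.reflection hv

/-- The 1/u coefficient multiplied on the right by κ⁻¹ in leg 1, which commutes with K₂₃(v). The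
four R-matrix terms then factor, with ρ 1 replaced by its conjugate in leg 1. -/
theorem IsKMatrix.classical_equation {𝔥₀ : LieSubalgebra ℂ 𝔤} (hR : IsQuasiClassicalR ρ S R)
    (hK : IsKMatrix ρ S R 𝔥₀ T K) (hb : IsOrthonormalBasis (killingForm ℂ 𝔤) b) (hκ : IsUnit κ)
    (hexp : HasExpansion (cobounded ℂ) (fun u => u⁻¹) K (λL κ) k₁) {v : ℂ} (hv : v ∈ T) :
    ∑ a, Λ₁ (ρ 0 (b a) + conjHom κ hκ (ρ 1) (b a)) *
        Λ₂₃ (λL (ρ 0 (b a)) * K v - K v * λL (ρ 1 (b a)))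
      + (Λ₁₃ (k₁ * λL κ⁻¹) * Λ₂₃ (K v) - Λ₂₃ (K v) * Λ₁₃ (k₁ * λL κ⁻¹)) = 0 := by
  have hdet := (Matrix.isUnit_iff_isUnit_det κ).mp hκ
  have hu : Λ₁ κ * Λ₁ κ⁻¹ = 1 := by rw [← map_mul, Matrix.mul_nonsing_inv κ hdet, map_one]
  have h := (hK.first_order hR hb hexp hv).2
  rw [leg13Hom_leftHom] at h
  have hKv := (leg1_commute_leg23Hom (m := Fin d) κ⁻¹ (K v)).eq
  have hsplit : ∀ a i, Λ₁ (conjHom κ hκ (ρ 1) (b a)) * Λ₂ (ρ i (b a)) =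
      Λ₁ κ * (Λ₁ (ρ 1 (b a)) * Λ₂ (ρ i (b a))) * Λ₁ κ⁻¹ := fun a i => by
    rw [conjHom_apply, map_mul, map_mul, mul_assoc, (leg1_commute_leg2 κ⁻¹ (ρ i (b a))).eq]
    noncomm_ring
  have t : ∀ a, Λ₁ (ρ 0 (b a) + conjHom κ hκ (ρ 1) (b a)) *
        Λ₂₃ (λL (ρ 0 (b a)) * K v - K v * λL (ρ 1 (b a))) =
      Λ₁ (ρ 0 (b a)) * Λ₂ (ρ 0 (b a)) * Λ₂₃ (K v)
        + Λ₁ κ * (Λ₁ (ρ 1 (b a)) * Λ₂ (ρ 0 (b a))) * Λ₁ κ⁻¹ * Λ₂₃ (K v)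
        - Λ₂₃ (K v) * (Λ₁ (ρ 0 (b a)) * Λ₂ (ρ 1 (b a)))
        - Λ₂₃ (K v) * (Λ₁ κ * (Λ₁ (ρ 1 (b a)) * Λ₂ (ρ 1 (b a))) * Λ₁ κ⁻¹) := fun a => by
    rw [← hsplit, ← hsplit, ← mul_assoc (Λ₂₃ (K v)), ← mul_assoc (Λ₂₃ (K v)),
      ← (leg1_commute_leg23Hom (ρ 0 (b a)) (K v)).eq,
      ← (leg1_commute_leg23Hom (conjHom κ hκ (ρ 1) (b a)) (K v)).eq, map_sub, map_mul, map_mul,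
      leg23Hom_leftHom, leg23Hom_leftHom, map_add]
    noncomm_ring
  have h2 := congrArg (· * Λ₁ κ⁻¹) h
  simp only [add_mul] at h2
  have e1 : ∀ Q, Q * Λ₁ κ * Λ₂₃ (K v) * Λ₁ κ⁻¹ = Q * Λ₂₃ (K v) := fun Q => by
    rw [mul_assoc, ← hKv, mul_assoc Q, ← mul_assoc (Λ₁ κ), hu, one_mul]
  have e2 : ∀ Q, Q * Λ₂₃ (K v) * Λ₁ κ⁻¹ = Q * Λ₁ κ⁻¹ * Λ₂₃ (K v) := fun Q => by
    rw [mul_assoc, ← hKv, mul_assoc]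
  have e3 : ∀ Q, Q * Λ₁ κ * Λ₁ κ⁻¹ = Q := fun Q => by rw [mul_assoc, hu, mul_one]
  rw [e1, e2, e2, e3] at h2
  rw [Finset.sum_congr rfl fun a _ => t a]
  simp only [Finset.sum_sub_distrib, Finset.sum_add_distrib, ← Finset.sum_mul, ← Finset.mul_sum]
  rw [map_mul, leg13Hom_leftHom, ← mul_assoc (Λ₂₃ (K v)) (Λ₁₃ k₁), ← sub_eq_zero.mpr h2]
  noncomm_ring

end

theorem slice_equation {P : ι → Matrix (Fin d) (Fin d) ℂ}
    {Q : ι → Matrix (Fin d × Fin dB) (Fin d × Fin dB) ℂ}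
    {k L : Matrix (Fin d × Fin dB) (Fin d × Fin dB) ℂ}
    (h : ∑ a, Λ₁ (P a) * Λ₂₃ (Q a) + (Λ₁₃ k * Λ₂₃ L - Λ₂₃ L * Λ₁₃ k) = 0) (i j : Fin d) :
    ∑ a, P a i j • Q a + (λR (block k i j) * L - L * λR (block k i j)) = 0 := by
  ext p q
  have := congrFun (congrFun h (i, p)) (j, q)
  rw [Matrix.add_apply, Matrix.sub_apply, Matrix.sum_apply, leg13Hom_mul_leg23Hom_apply,
    leg23Hom_mul_leg13Hom_apply] at this
  simp only [leg1_mul_leg23Hom_apply] at this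
  rw [Matrix.add_apply, Matrix.sub_apply, Matrix.sum_apply]
  exact this

/-- As v → ∞, K(v) tends to κ ⊗ 1, which commutes with every boundary block, so the commutator term
drops out. -/
theorem classical_limit [Nonempty (Fin dB)] (hT : T ∈ cobounded ℂ) (hκ : IsUnit κ)
    (hexp : HasExpansion (cobounded ℂ) (fun u => u⁻¹) K (λL κ) k₁)
    {k : Matrix (Fin d × Fin dB) (Fin d × Fin dB) ℂ}
    {P : ι → Matrix (Fin d) (Fin d) ℂ} {x : ι → 𝔤}
    (h : ∀ v ∈ T, ∑ a, Λ₁ (P a) * Λ₂₃ (λL (ρ 0 (x a)) * K v - K v * λL (ρ 1 (x a)))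
      + (Λ₁₃ k * Λ₂₃ (K v) - Λ₂₃ (K v) * Λ₁₃ k) = 0) (i j : Fin d) :
    ∑ a, P a i j • (ρ 0 (x a) - conjHom κ hκ (ρ 1) (x a)) = 0 := by
  have hdet := (Matrix.isUnit_iff_isUnit_det κ).mp hκ
  have h1 := (hexp.linear_relation hT
    (∑ a, P a i j • (LinearMap.mulLeft ℂ (λL (ρ 0 (x a))) - LinearMap.mulRight ℂ (λL (ρ 1 (x a))))
      + (LinearMap.mulLeft ℂ (λR (block k i j)) - LinearMap.mulRight ℂ (λR (block k i j))))
    fun v hv => by simpa using slice_equation (h v hv) i j).1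
  have h2 : λR (block k i j) * λL κ = λL κ * λR (block k i j) := by
    rw [rightHom_mul_leftHom, leftHom_mul_rightHom]
  have h3 : λL (∑ a, P a i j • (ρ 0 (x a) * κ - κ * ρ 1 (x a))) = λL 0 := by
    simpa [h2] using h1
  have h4 := congrArg (· * κ⁻¹) (leftHom_injective h3)
  simp only [zero_mul, Finset.sum_mul, smul_mul_assoc, sub_mul] at h4
  rw [← h4]
  refine Finset.sum_congr rfl fun a _ => ?_
  rw [conjHom_apply, Matrix.mul_nonsing_inv_cancel_right _ _ hdet]

end FirstOrder

/-! ### The representation of 𝔥 on the boundary space -/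

section BoundaryHom

variable {𝔥 : Type*} [LieRing 𝔥] [LieAlgebra ℂ 𝔥] {d dB : ℕ} {T : Set ℂ}
  {K : ℂ → Matrix (Fin d × Fin dB) (Fin d × Fin dB) ℂ}
  {ι : Type*} [Fintype ι] [DecidableEq ι]

local notation "λL" => leftHom (Fin d) (Fin dB)
local notation "λR" => rightHom (Fin d) (Fin dB)

/-- Functionals dual to φ(e_a) isolate one basis vector at a time; τ is the corresponding
contraction of the G i j. -/
theorem exists_boundary_map (e : Module.Basis ι ℂ 𝔥) (φ ψ : 𝔥 →ₗ[ℂ] Matrix (Fin d) (Fin d) ℂ)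
    (hφ : Function.Injective φ) (G : Fin d → Fin d → Matrix (Fin dB) (Fin dB) ℂ)
    (h : ∀ v ∈ T, ∀ i j, ∑ a, φ (e a) i j • (λL (φ (e a)) * K v - K v * λL (ψ (e a)))
      + (λR (G i j) * K v - K v * λR (G i j)) = 0) :
    ∃ τ : 𝔥 →ₗ[ℂ] Matrix (Fin dB) (Fin dB) ℂ, ∀ v ∈ T, ∀ x,
      λL (φ x) * K v - K v * λL (ψ x) + (λR (τ x) * K v - K v * λR (τ x)) = 0 := by
  obtain ⟨f, hf⟩ := exists_dual_functional e φ hφ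
  let τ : 𝔥 →ₗ[ℂ] Matrix (Fin dB) (Fin dB) ℂ :=
    e.constr ℂ fun c => ∑ i, ∑ j, f c (Matrix.single i j 1) • G i j
  refine ⟨τ, fun v hv => ?_⟩
  have hlin : (LinearMap.mulRight ℂ (K v)) ∘ₗ (λL).toLinearMap ∘ₗ φ
      - (LinearMap.mulLeft ℂ (K v)) ∘ₗ (λL).toLinearMap ∘ₗ ψ
      + ((LinearMap.mulRight ℂ (K v)) ∘ₗ (λR).toLinearMap ∘ₗ τ
      - (LinearMap.mulLeft ℂ (K v)) ∘ₗ (λR).toLinearMap ∘ₗ τ) = 0 := by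
    refine e.ext fun c => ?_
    have h1 := sum_functional_smul (f c) (fun a => φ (e a))
      (fun a => λL (φ (e a)) * K v - K v * λL (ψ (e a)))
    have h2 : ∑ a, f c (φ (e a)) • (λL (φ (e a)) * K v - K v * λL (ψ (e a))) =
        λL (φ (e c)) * K v - K v * λL (ψ (e c)) := by
      simp [hf]
    rw [h2] at h1
    simp only [LinearMap.add_apply, LinearMap.sub_apply, LinearMap.comp_apply,
      LinearMap.mulLeft_apply, LinearMap.mulRight_apply, AlgHom.toLinearMap_apply,
      LinearMap.zero_apply]
    rw [h1, Module.Basis.constr_basis]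
    simp only [map_sum, map_smul, Finset.sum_mul, Finset.mul_sum, smul_mul_assoc, mul_smul_comm,
      ← Finset.sum_sub_distrib, ← smul_sub, ← Finset.sum_add_distrib, ← smul_add]
    refine Finset.sum_eq_zero fun i _ => Finset.sum_eq_zero fun j _ => ?_
    have := h v hv i j
    rw [this, smul_zero]
  exact fun x => LinearMap.congr_fun hlin x

/-- Since φ and ψ are homomorphisms, the bracket defect of τ commutes with K and is scalar by Schur.
Making τ traceless leaves the relation intact, and the defect, now a traceless scalar, is 0. -/
theorem exists_boundary_hom (hirr : IsIrreducibleK T K)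
    (φ ψ : 𝔥 →ₗ⁅ℂ⁆ Matrix (Fin d) (Fin d) ℂ) (τ : 𝔥 →ₗ[ℂ] Matrix (Fin dB) (Fin dB) ℂ)
    (h : ∀ v ∈ T, ∀ x,
      λL (φ x) * K v - K v * λL (ψ x) + (λR (τ x) * K v - K v * λR (τ x)) = 0) :
    ∃ σ : 𝔥 →ₗ⁅ℂ⁆ Matrix (Fin dB) (Fin dB) ℂ, ∀ v ∈ T, ∀ x,
      λL (φ x) * K v - K v * λL (ψ x) + (λR (σ x) * K v - K v * λR (σ x)) = 0 := by
  have hdB : (dB : ℂ) ≠ 0 := by exact_mod_cast hirr.1.ne'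
  let σ : 𝔥 →ₗ[ℂ] Matrix (Fin dB) (Fin dB) ℂ :=
    τ - LinearMap.toSpanSingleton ℂ _ 1 ∘ₗ ((dB : ℂ)⁻¹ • Matrix.traceLinearMap (Fin dB) ℂ ℂ) ∘ₗ τ
  have hσ : ∀ x, σ x = τ x - ((dB : ℂ)⁻¹ * (τ x).trace) • 1 := fun x => by simp [σ]
  have htr : ∀ x, (σ x).trace = 0 := fun x => by
    rw [hσ, Matrix.trace_sub, Matrix.trace_smul, Matrix.trace_one, Fintype.card_fin, smul_eq_mul]
    field_simp
    ring
  have hint : ∀ v ∈ T, ∀ x, (λL (φ x) + λR (σ x)) * K v = K v * (λL (ψ x) + λR (σ x)) := by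
    intro v hv x
    have := h v hv x
    rw [← sub_eq_zero, ← this, hσ, map_sub, map_smul, map_one]
    simp only [add_mul, mul_add, sub_mul, mul_sub, smul_mul_assoc, mul_smul_comm, one_mul, mul_one]
    abel
  have hbr : ∀ (θ : 𝔥 →ₗ⁅ℂ⁆ Matrix (Fin d) (Fin d) ℂ) x y,
      (λL (θ x) + λR (σ x)) * (λL (θ y) + λR (σ y)) - (λL (θ y) + λR (σ y)) * (λL (θ x) + λR (σ x))
        - (λL (θ ⁅x, y⁆) + λR (σ ⁅x, y⁆)) = λR (σ x * σ y - σ y * σ x - σ ⁅x, y⁆) := by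
    intro θ x y
    simp only [LieHom.map_lie, Ring.lie_def, map_sub, map_mul]
    have h1 : λR (σ y) * λL (θ x) = λL (θ x) * λR (σ y) := by
      rw [rightHom_mul_leftHom, leftHom_mul_rightHom]
    have h2 : λR (σ x) * λL (θ y) = λL (θ y) * λR (σ x) := by
      rw [rightHom_mul_leftHom, leftHom_mul_rightHom]
    simp only [mul_add, add_mul, h1, h2]
    abel
  have hmul : ∀ v ∈ T, ∀ x y, (λL (φ x) + λR (σ x)) * (λL (φ y) + λR (σ y)) * K v =
      K v * ((λL (ψ x) + λR (σ x)) * (λL (ψ y) + λR (σ y))) := fun v hv x y => by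
    rw [mul_assoc, hint v hv y, ← mul_assoc, hint v hv x, mul_assoc]
  refine ⟨{ σ with map_lie' := fun {x y} => ?_ }, fun v hv x => ?_⟩
  · change σ ⁅x, y⁆ = ⁅σ x, σ y⁆
    obtain ⟨c, hc⟩ := hirr.exists_eq_smul_one (Q := σ x * σ y - σ y * σ x - σ ⁅x, y⁆)
      fun v hv => by
        conv_lhs => rw [← hbr φ x y]
        conv_rhs => rw [← hbr ψ x y]
        simp only [sub_mul, mul_sub, hmul v hv, hint v hv]
    have ht := congrArg Matrix.trace hc
    rw [Matrix.trace_sub, Matrix.trace_sub, Matrix.trace_mul_comm, sub_self, htr, sub_zero,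
      Matrix.trace_smul, Matrix.trace_one, Fintype.card_fin, smul_eq_mul] at ht
    have hc0 : c = 0 := (mul_eq_zero.mp ht.symm).resolve_right hdB
    rw [hc0, zero_smul, sub_eq_zero] at hc
    rw [← hc, Ring.lie_def]
  · change λL (φ x) * K v - K v * λL (ψ x) + (λR (σ x) * K v - K v * λR (σ x)) = 0
    rw [← sub_eq_zero.mpr (hint v hv x), add_mul, mul_add]
    abel

end BoundaryHom

/-! ### The equation at second order -/

section SecondOrder

open scoped Matrix.Norms.Operator

variable {𝔤 : Type*} [LieRing 𝔤] [LieAlgebra ℂ 𝔤] [FiniteDimensional ℂ 𝔤] {d dB : ℕ}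
  {ρ : Fin 2 → 𝔤 →ₗ⁅ℂ⁆ Matrix (Fin d) (Fin d) ℂ}
  {S T : Set ℂ} {R : Fin 2 → Fin 2 → ℂ → Matrix (Fin d × Fin d) (Fin d × Fin d) ℂ}
  {K : ℂ → Matrix (Fin d × Fin dB) (Fin d × Fin dB) ℂ}
  {k₁ : Matrix (Fin d × Fin dB) (Fin d × Fin dB) ℂ}
  {κ : Matrix (Fin d) (Fin d) ℂ} {α : 𝔤 →ₗ⁅ℂ⁆ 𝔤} {p q : ℕ}
  {e : Module.Basis (Fin p) ℂ (fixedSubalgebra α)} {b : Module.Basis (Fin p ⊕ Fin q) ℂ 𝔤}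

local notation "Λ₁" => leg1 (Fin d) (Fin d) (Fin dB)
local notation "Λ₂" => leg2 (Fin d) (Fin d) (Fin dB)
local notation "Λ₃" => leg3 (Fin d) (Fin d) (Fin dB)
local notation "Λ₁₃" => leg13Hom (Fin d) (Fin d) (Fin dB)
local notation "Λ₂₃" => leg23Hom (Fin d) (Fin d) (Fin dB)
local notation "λL" => leftHom (Fin d) (Fin dB)

theorem lie_apply_of_algHom {𝔨 A : Type*} [LieRing 𝔨] [LieAlgebra ℂ 𝔨] [Ring A] [Algebra ℂ A]
    {n : Type*} [Fintype n] [DecidableEq n] (φ : 𝔨 →ₗ⁅ℂ⁆ Matrix n n ℂ)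
    (Λ : Matrix n n ℂ →ₐ[ℂ] A) (x y : 𝔨) :
    Λ (φ x) * Λ (φ y) - Λ (φ y) * Λ (φ x) = Λ (φ ⁅x, y⁆) := by
  rw [LieHom.map_lie, Ring.lie_def, map_sub, map_mul, map_mul]

/-- An element that commutes with the split Casimir element in two commuting copies. -/
theorem IsOrthonormalBasis.commute_add {𝔨 A ι : Type*} [LieRing 𝔨] [LieAlgebra ℂ 𝔨] [Ring A]
    [Algebra ℂ A] [Fintype ι] [DecidableEq ι] {B : LinearMap.BilinForm ℂ 𝔨}
    {e : Module.Basis ι ℂ 𝔨} (h : IsOrthonormalBasis B e)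
    (hB : ∀ x y z : 𝔨, B ⁅x, y⁆ z = -B y ⁅x, z⁆) {m n : Type*} [Fintype m] [DecidableEq m]
    [Fintype n] [DecidableEq n] (φ : 𝔨 →ₗ⁅ℂ⁆ Matrix m m ℂ) (ψ : 𝔨 →ₗ⁅ℂ⁆ Matrix n n ℂ)
    (Λ : Matrix m m ℂ →ₐ[ℂ] A) (Λ' : Matrix n n ℂ →ₐ[ℂ] A)
    (hcomm : ∀ X Y, Commute (Λ X) (Λ' Y)) (x : 𝔨) :
    Commute (Λ (φ x) + Λ' (ψ x)) (∑ a, Λ (φ (e a)) * Λ' (ψ (e a))) := by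
  refine h.commute_sum_mul hB (Λ.toLinearMap ∘ₗ (φ : 𝔨 →ₗ[ℂ] Matrix m m ℂ))
    (Λ'.toLinearMap ∘ₗ (ψ : 𝔨 →ₗ[ℂ] Matrix n n ℂ)) x (fun y => ?_) (fun y => ?_)
  · change (Λ (φ x) + Λ' (ψ x)) * Λ (φ y) - Λ (φ y) * (Λ (φ x) + Λ' (ψ x)) = Λ (φ ⁅x, y⁆)
    rw [← lie_apply_of_algHom, add_mul, mul_add, (hcomm (φ y) (ψ x)).eq]
    abel
  · change (Λ (φ x) + Λ' (ψ x)) * Λ' (ψ y) - Λ' (ψ y) * (Λ (φ x) + Λ' (ψ x)) = Λ' (ψ ⁅x, y⁆)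
    rw [← lie_apply_of_algHom, add_mul, mul_add, (hcomm (φ x) (ψ y)).eq]
    abel

theorem killingOn_lie (𝔥 : LieSubalgebra ℂ 𝔤) (x y z : 𝔥) :
    killingOn 𝔥 ⁅x, y⁆ z = -killingOn 𝔥 y ⁅x, z⁆ :=
  killingForm_lie (x : 𝔤) y z

theorem commutatorSum_legs
    (he : IsOrthonormalBasis (killingOn (fixedSubalgebra α)) e)
    (hb : IsOrthonormalBasis (killingForm ℂ 𝔤) b) (hbe : ∀ a, b (Sum.inl a) = e a)
    (r : 𝔤 →ₗ⁅ℂ⁆ Matrix (Fin d) (Fin d) ℂ)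
    (ρB : fixedSubalgebra α →ₗ⁅ℂ⁆ Matrix (Fin dB) (Fin dB) ℂ)
    (E c' : Matrix (Fin d) (Fin d) ℂ) (hE : ∀ a, Commute E (r (e a)))
    (hc' : c' = ∑ a, r (e a) * r (e a))
    {c : ℂ} (hc0 : c ≠ 0) (hc1 : c + 1 ≠ 0) (hc2 : c - 1 ≠ 0) :
    commutatorSum c
      (∑ a, Λ₁ (r (e a)) * Λ₂ (r (e a)) + ∑ a, Λ₁ (r (b (Sum.inr a))) * Λ₂ (r (b (Sum.inr a))))
      (∑ a, Λ₁ (r (e a)) * Λ₂ (r (e a)) - ∑ a, Λ₁ (r (b (Sum.inr a))) * Λ₂ (r (b (Sum.inr a))))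
      (Λ₁ E + (2 : ℂ) • ∑ a, Λ₁ (r (e a)) * Λ₃ (ρB (e a)))
      (Λ₂ E + (2 : ℂ) • ∑ a, Λ₂ (r (e a)) * Λ₃ (ρB (e a))) =
    (2 / c) • ((∑ a, Λ₁ (r (b (Sum.inr a))) * Λ₂ (r (b (Sum.inr a)))) *
        (Λ₁ E + Λ₂ E - (1 / 2 : ℂ) • (Λ₁ c' + Λ₂ c')) -
      (Λ₁ E + Λ₂ E - (1 / 2 : ℂ) • (Λ₁ c' + Λ₂ c')) *
        (∑ a, Λ₁ (r (b (Sum.inr a))) * Λ₂ (r (b (Sum.inr a))))) := by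
  set H := ∑ a, Λ₁ (r (e a)) * Λ₂ (r (e a)) with hH
  set M := ∑ a, Λ₁ (r (b (Sum.inr a))) * Λ₂ (r (b (Sum.inr a)))
  have c12 := fun X Y : Matrix (Fin d) (Fin d) ℂ => leg1_commute_leg2 (n := Fin dB) X Y
  have c13 := fun (X : Matrix (Fin d) (Fin d) ℂ) (Y : Matrix (Fin dB) (Fin dB) ℂ) =>
    leg1_commute_leg3 (m := Fin d) X Y
  have c23 := fun (X : Matrix (Fin d) (Fin d) ℂ) (Y : Matrix (Fin dB) (Fin dB) ℂ) =>
    leg2_commute_leg3 (l := Fin d) X Y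
  have hHM : ∀ x : 𝔤, Commute (Λ₁ (r x) + Λ₂ (r x)) (H + M) := fun x => by
    have := hb.commute_add killingForm_lie r r Λ₁ Λ₂ c12 x
    rw [Fintype.sum_sum_type] at this
    simpa only [hbe] using this
  have hHe : ∀ x : fixedSubalgebra α, Commute (Λ₁ (r x) + Λ₂ (r x)) H := fun x =>
    he.commute_add (killingOn_lie _) (r.comp (fixedSubalgebra α).incl)
      (r.comp (fixedSubalgebra α).incl) Λ₁ Λ₂ c12 x
  have hMe : ∀ x : fixedSubalgebra α, Commute (Λ₁ (r x) + Λ₂ (r x)) M := fun x => by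
    simpa using (hHM x).sub_right (hHe x)
  have hsum : ∑ a, Λ₁ (r (e a)) * Λ₃ (ρB (e a)) + ∑ a, Λ₂ (r (e a)) * Λ₃ (ρB (e a)) =
      ∑ a, (Λ₁ (r (e a)) + Λ₂ (r (e a))) * Λ₃ (ρB (e a)) := by
    simp only [add_mul, Finset.sum_add_distrib]
  have h3H : ∀ Y, Commute (Λ₃ Y) H := fun Y => Commute.sum_right _ _ _ fun a _ =>
    (c13 _ _).symm.mul_right (c23 _ _).symm
  have h3M : ∀ Y, Commute (Λ₃ Y) M := fun Y => Commute.sum_right _ _ _ fun a _ =>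
    (c13 _ _).symm.mul_right (c23 _ _).symm
  have hE' : ∀ Λ : Matrix (Fin d) (Fin d) ℂ →ₐ[ℂ] Matrix (Fin d × Fin d × Fin dB)
      (Fin d × Fin d × Fin dB) ℂ, ∀ a, Commute (Λ (r (e a))) (Λ E) := fun Λ a =>
    (hE a).symm.map Λ
  refine commutatorSum_eq ?_ ?_ ?_ ?_ ?_ ?_ ?_ (c12 _ _) ?_ hc0 hc1 hc2
  · rw [hsum]
    exact Commute.sum_right _ _ _ fun a _ => (hHe _).symm.mul_right (h3H _).symm
  · rw [hsum]
    exact Commute.sum_right _ _ _ fun a _ => (hMe _).symm.mul_right (h3M _).symm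
  -- The invariance of X under the joint action of 𝔥 on legs 1 and 3 gives [X, H + Y] = 0, an
  -- infinitesimal braid relation.
  · have hX := fun x => he.commute_add (killingOn_lie _) (r.comp (fixedSubalgebra α).incl) ρB
      Λ₁ Λ₃ c13 x
    have hs : H + ∑ a, Λ₂ (r (e a)) * Λ₃ (ρB (e a)) =
        ∑ a, (Λ₁ (r (e a)) + Λ₃ (ρB (e a))) * Λ₂ (r (e a)) := by
      rw [hH, ← Finset.sum_add_distrib]
      refine Finset.sum_congr rfl fun a _ => ?_
      rw [add_mul, (c23 _ _).eq]
    have hc : Commute (∑ a, Λ₁ (r (e a)) * Λ₃ (ρB (e a)))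
        (H + ∑ a, Λ₂ (r (e a)) * Λ₃ (ρB (e a))) := by
      rw [hs]
      refine Commute.sum_right _ _ _ fun a _ => Commute.mul_right (hX (e a)).symm ?_
      exact Commute.sum_left _ _ _ fun a' _ => (c12 _ _).mul_left (c23 _ _).symm
    have := hc.eq
    rw [mul_add, add_mul] at this
    rw [sub_eq_sub_iff_add_eq_add, add_comm, this]
  · exact Commute.sum_left _ _ _ fun a _ => (hE' Λ₁ a).mul_left (c12 _ _).symm
  · exact Commute.sum_left _ _ _ fun a _ => (c12 _ _).mul_left (hE' Λ₂ a)
  · exact Commute.sum_right _ _ _ fun a _ => (c12 _ _).mul_right (c13 _ _)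
  · exact Commute.sum_left _ _ _ fun a _ => (c12 _ _).mul_left (c23 _ _).symm
  -- This is the Casimir of 𝔥 acting diagonally on legs 1 and 2, and M is 𝔥-invariant.
  · have hs : (2 : ℂ) • H + (Λ₁ c' + Λ₂ c') =
        ∑ a, (Λ₁ (r (e a)) + Λ₂ (r (e a))) * (Λ₁ (r (e a)) + Λ₂ (r (e a))) := by
      rw [hH, hc', map_sum, map_sum, Finset.smul_sum, ← Finset.sum_add_distrib,
        ← Finset.sum_add_distrib]
      refine Finset.sum_congr rfl fun a _ => ?_
      rw [map_mul, map_mul, add_mul, mul_add, mul_add, (c12 (r (e a)) (r (e a))).eq, two_smul]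
      abel
    rw [hs]
    exact Commute.sum_right _ _ _ fun a _ => (hMe _).symm.mul_right (hMe _).symm

theorem HasExpansion.conj {α A : Type*} [NormedRing A] [NormedAlgebra ℂ A] {l : Filter α}
    {s : α → ℂ} (hs : Tendsto s l (𝓝 0)) {f : α → A} {A₁ g g' : A} (hg : g * g' = 1)
    (hf : HasExpansion l s f 1 A₁) :
    HasExpansion l s (fun t => g * f t * g') 1 (g * A₁ * g') := by
  have := ((HasExpansion.const g).mul hs hf).mul hs (HasExpansion.const g')
  simpa [hg] using this

theorem conj_sum_left {A ι : Type*} [Ring A] [Fintype ι] (x y : ι → A) (g g' : A)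
    (h : ∀ a, Commute g' (y a)) : g * (∑ a, x a * y a) * g' = ∑ a, g * x a * g' * y a := by
  rw [Finset.mul_sum, Finset.sum_mul]
  refine Finset.sum_congr rfl fun a _ => ?_
  rw [mul_assoc (g * x a), (h a).eq]
  noncomm_ring

theorem conj_sum_right {A ι : Type*} [Ring A] [Fintype ι] (x y : ι → A) (g g' : A)
    (h : ∀ a, Commute (x a) g) : g * (∑ a, x a * y a) * g' = ∑ a, x a * (g * y a * g') := by
  rw [Finset.mul_sum, Finset.sum_mul]
  refine Finset.sum_congr rfl fun a _ => ?_
  rw [← mul_assoc, ← (h a).eq]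
  noncomm_ring

/-- Multiplying the K-matrices of a boundary Yang-Baxter equation by constant matrices. -/
theorem reflection_conj {A : Type*} [Ring A] {A₁ A₂ A₃ A₄ K₁ K₂ g₁ g₁' g₂ g₂' : A}
    (h : A₁ * K₁ * A₂ * K₂ = K₂ * A₃ * K₁ * A₄) (h₁ : g₁' * g₁ = 1) (h₂ : g₂' * g₂ = 1)
    (d₁ : Commute g₁' K₂) (d₂ : Commute g₂' K₁) (d : Commute g₁' g₂') :
    A₁ * (K₁ * g₁') * (g₁ * A₂ * g₁') * (K₂ * g₂') =
      K₂ * g₂' * (g₂ * A₃ * g₂') * (K₁ * g₁') * (g₁ * (g₂ * A₄ * g₂') * g₁') := by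
  calc _ = A₁ * K₁ * (g₁' * g₁) * A₂ * (g₁' * K₂) * g₂' := by noncomm_ring
    _ = A₁ * K₁ * A₂ * K₂ * (g₁' * g₂') := by rw [h₁, d₁.eq]; noncomm_ring
    _ = K₂ * A₃ * K₁ * A₄ * (g₂' * g₁') := by rw [h, d.eq]
    _ = K₂ * A₃ * K₁ * (g₂' * g₂) * A₄ * (g₂' * g₁') := by rw [h₂, mul_one]
    _ = K₂ * A₃ * (g₂' * K₁) * g₂ * A₄ * (g₂' * g₁') := by rw [d₂.eq]; noncomm_ring
    _ = K₂ * (g₂' * g₂) * A₃ * (g₂' * K₁) * (g₁' * g₁) * g₂ * A₄ * (g₂' * g₁') := by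
        rw [h₁, h₂, mul_one, mul_one]
    _ = _ := by noncomm_ring

/-- Replacing K by Kκ⁻¹ normalises the leading term to 1 and conjugates the R-matrices. A twist by α
in one leg changes H + M to H − M; twists in both legs restore H + M. This is the shape needed for
`commutatorSum_legs`. -/
theorem IsKMatrix.second_order {𝔥₀ : LieSubalgebra ℂ 𝔤} (hR : IsQuasiClassicalR ρ S R)
    (hK : IsKMatrix ρ S R 𝔥₀ T K) (hκ : IsUnit κ)
    (hexp : HasExpansion (cobounded ℂ) (fun u => u⁻¹) K (λL κ) k₁)
    (hα : ∀ x, κ * ρ 1 x * κ⁻¹ = ρ 0 (α x))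
    (he : IsOrthonormalBasis (killingOn (fixedSubalgebra α)) e)
    (hb : IsOrthonormalBasis (killingForm ℂ 𝔤) b) (hbe : ∀ a, b (Sum.inl a) = e a)
    (hbα : ∀ a, α (b (Sum.inr a)) = -b (Sum.inr a))
    (ρB : fixedSubalgebra α →ₗ⁅ℂ⁆ Matrix (Fin dB) (Fin dB) ℂ)
    {E c' : Matrix (Fin d) (Fin d) ℂ} (hE : ∀ a, Commute E (ρ 0 (e a)))
    (hc' : c' = ∑ a, ρ 0 (e a) * ρ 0 (e a))
    (hk : k₁ * λL κ⁻¹ = λL E + (2 : ℂ) • ∑ a, ρ 0 (e a) ⊗ₖ ρB (e a)) :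
    (∑ a, Λ₁ (ρ 0 (b (Sum.inr a))) * Λ₂ (ρ 0 (b (Sum.inr a)))) *
        (Λ₁ E + Λ₂ E - (1 / 2 : ℂ) • (Λ₁ c' + Λ₂ c')) -
      (Λ₁ E + Λ₂ E - (1 / 2 : ℂ) • (Λ₁ c' + Λ₂ c')) *
        (∑ a, Λ₁ (ρ 0 (b (Sum.inr a))) * Λ₂ (ρ 0 (b (Sum.inr a)))) = 0 := by
  have hdet := (Matrix.isUnit_iff_isUnit_det κ).mp hκ
  have hs := tendsto_inv_cobounded_zero
  have hκκ : κ * κ⁻¹ = 1 := Matrix.mul_nonsing_inv κ hdet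
  have hκκ' : κ⁻¹ * κ = 1 := Matrix.nonsing_inv_mul κ hdet
  have u1 : Λ₁ κ * Λ₁ κ⁻¹ = 1 := by rw [← map_mul, hκκ, map_one]
  have u2 : Λ₂ κ * Λ₂ κ⁻¹ = 1 := by rw [← map_mul, hκκ, map_one]
  have hLexp : HasExpansion (cobounded ℂ) (fun u => u⁻¹) (fun u => K u * λL κ⁻¹) 1
      (k₁ * λL κ⁻¹) := by
    have := hexp.mul hs (HasExpansion.const (λL κ⁻¹))
    rwa [← map_mul, hκκ, map_one, mul_zero, add_zero] at this
  have hL := hLexp.map (Λ₁₃).toLinearMap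
  have hM := hLexp.map (Λ₂₃).toLinearMap
  simp only [AlgHom.toLinearMap_apply, map_one] at hL hM
  have m1 : ∀ x, Λ₁ κ * Λ₁ (ρ 1 x) * Λ₁ κ⁻¹ = Λ₁ (ρ 0 (α x)) := fun x => by
    rw [← map_mul, ← map_mul, hα]
  have m2 : ∀ x, Λ₂ κ * Λ₂ (ρ 1 x) * Λ₂ κ⁻¹ = Λ₂ (ρ 0 (α x)) := fun x => by
    rw [← map_mul, ← map_mul, hα]
  have αl : ∀ a, α (e a) = e a := fun a => (e a).2
  have h1 := hR.expansion (dB := dB) hb 0 0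
  have h2 := HasExpansion.conj hs u1 (hR.expansion_flip (dB := dB) hb 0 1)
  have h3 := HasExpansion.conj hs u2 (hR.expansion (dB := dB) hb 0 1)
  have h4 := HasExpansion.conj hs u1
    (HasExpansion.conj hs u2 (hR.expansion_flip (dB := dB) hb 1 1))
  have w2 := conj_sum_left (fun a => Λ₁ (ρ 1 (b a))) (fun a => Λ₂ (ρ 0 (b a))) (Λ₁ κ) (Λ₁ κ⁻¹)
    fun a => leg1_commute_leg2 _ _
  have w3 := conj_sum_right (fun a => Λ₁ (ρ 0 (b a))) (fun a => Λ₂ (ρ 1 (b a))) (Λ₂ κ) (Λ₂ κ⁻¹)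
    fun a => leg1_commute_leg2 _ _
  have w4 := conj_sum_left (fun a => Λ₁ (ρ 1 (b a))) (fun a => Λ₂ κ * Λ₂ (ρ 1 (b a)) * Λ₂ κ⁻¹)
    (Λ₁ κ) (Λ₁ κ⁻¹) fun a =>
      ((leg1_commute_leg2 _ _).mul_right (leg1_commute_leg2 _ _)).mul_right (leg1_commute_leg2 _ _)
  rw [← conj_sum_right _ _ _ _ fun a => leg1_commute_leg2 _ _] at w4
  simp only [m1, m2] at w2 w3 w4
  rw [w2] at h2
  rw [w3] at h3
  rw [w4] at h4
  rw [Fintype.sum_sum_type] at h1 h2 h3 h4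
  simp only [αl, hbα, hbe, map_neg, neg_mul, mul_neg, neg_neg, Finset.sum_neg_distrib,
    ← sub_eq_add_neg] at h1 h2 h3 h4
  have hk13 : Λ₁₃ (k₁ * λL κ⁻¹) = Λ₁ E + (2 : ℂ) • ∑ a, Λ₁ (ρ 0 (e a)) * Λ₃ (ρB (e a)) := by
    rw [hk, map_add, map_smul, map_sum, leg13Hom_leftHom]
    simp only [leg13Hom_kronecker]
  have hk23 : Λ₂₃ (k₁ * λL κ⁻¹) = Λ₂ E + (2 : ℂ) • ∑ a, Λ₂ (ρ 0 (e a)) * Λ₃ (ρB (e a)) := by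
    rw [hk, map_add, map_smul, map_sum, leg23Hom_leftHom]
    simp only [leg23Hom_kronecker]
  rw [hk13] at hL
  rw [hk23] at hM
  refine eq_zero_of_reflection hR.regular hK.regular h1 h2 h3 h4 hL hM ?_ fun c hc0 hc1 hc2 =>
    commutatorSum_legs he hb hbe (ρ 0) ρB E c' hE hc' hc0 hc1 hc2
  intro u hu v hv hm hp
  have h := hK.reflection u hu v hv hm hp
  simp only [map_mul, leg13Hom_leftHom, leg23Hom_leftHom]
  exact reflection_conj h (by rw [← map_mul, hκκ', map_one]) (by rw [← map_mul, hκκ', map_one])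
    (leg1_commute_leg23Hom (m := Fin d) κ⁻¹ (K v)) (leg2_commute_leg13Hom (m := Fin d) κ⁻¹ (K u))
    (leg1_commute_leg2 κ⁻¹ κ⁻¹)

end SecondOrder

/-! ### The form of the 1/u coefficient -/

section Residue

open scoped Matrix.Norms.Operator

variable {𝔤 : Type*} [LieRing 𝔤] [LieAlgebra ℂ 𝔤] [FiniteDimensional ℂ 𝔤] {d dB : ℕ}
  {ρ : Fin 2 → 𝔤 →ₗ⁅ℂ⁆ Matrix (Fin d) (Fin d) ℂ}
  {S T : Set ℂ} {R : Fin 2 → Fin 2 → ℂ → Matrix (Fin d × Fin d) (Fin d × Fin d) ℂ}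
  {K : ℂ → Matrix (Fin d × Fin dB) (Fin d × Fin dB) ℂ}
  {k₁ : Matrix (Fin d × Fin dB) (Fin d × Fin dB) ℂ}
  {κ : Matrix (Fin d) (Fin d) ℂ} {α : 𝔤 →ₗ⁅ℂ⁆ 𝔤} {p q : ℕ}
  {e : Module.Basis (Fin p) ℂ (fixedSubalgebra α)} {b : Module.Basis (Fin p ⊕ Fin q) ℂ 𝔤}

local notation "Λ₁" => leg1 (Fin d) (Fin d) (Fin dB)
local notation "Λ₂" => leg2 (Fin d) (Fin d) (Fin dB)
local notation "Λ₃" => leg3 (Fin d) (Fin d) (Fin dB)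
local notation "Λ₁₃" => leg13Hom (Fin d) (Fin d) (Fin dB)
local notation "Λ₂₃" => leg23Hom (Fin d) (Fin d) (Fin dB)
local notation "λL" => leftHom (Fin d) (Fin dB)
local notation "λR" => rightHom (Fin d) (Fin dB)

/-- ρ 0 + ρ 0∘α is 2ρ 0 on 𝔥 and 0 on the −1 eigenspace; the factor ½ on k₁ compensates the
doubling. -/
theorem IsKMatrix.fixed_equation {𝔥₀ : LieSubalgebra ℂ 𝔤} (hR : IsQuasiClassicalR ρ S R)
    (hK : IsKMatrix ρ S R 𝔥₀ T K) (hκ : IsUnit κ)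
    (hexp : HasExpansion (cobounded ℂ) (fun u => u⁻¹) K (λL κ) k₁)
    (hα : ∀ x, κ * ρ 1 x * κ⁻¹ = ρ 0 (α x))
    (hb : IsOrthonormalBasis (killingForm ℂ 𝔤) b) (hbe : ∀ a, b (Sum.inl a) = e a)
    (hbα : ∀ a, α (b (Sum.inr a)) = -b (Sum.inr a)) {v : ℂ} (hv : v ∈ T) :
    ∑ a, Λ₁ (ρ 0 (e a)) * Λ₂₃ (λL (ρ 0 (e a)) * K v - K v * λL (ρ 1 (e a)))
      + (Λ₁₃ ((1 / 2 : ℂ) • (k₁ * λL κ⁻¹)) * Λ₂₃ (K v)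
        - Λ₂₃ (K v) * Λ₁₃ ((1 / 2 : ℂ) • (k₁ * λL κ⁻¹))) = 0 := by
  have h := hK.classical_equation hR hb hκ hexp hv
  have αl : ∀ a, α (e a) = e a := fun a => (e a).2
  rw [Fintype.sum_sum_type] at h
  simp only [conjHom_apply, hα, hbα, map_neg, add_neg_cancel, map_zero, zero_mul,
    Finset.sum_const_zero, add_zero, hbe, αl, ← two_smul ℂ (ρ 0 _), map_smul,
    smul_mul_assoc, ← Finset.smul_sum] at h
  have h' := congrArg (fun Q => (1 / 2 : ℂ) • Q) h
  simp only [smul_add, smul_smul, smul_zero] at h'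
  rw [map_smul, smul_mul_assoc, mul_smul_comm, ← smul_sub, ← h']
  norm_num

/-- Once ρB is known, the symmetry turns the sum in `h` into a commutator with K₂₃. Thus k minus the
𝔥-Casimir tensor commutes with K₂₃, and Schur makes it act on leg 1 alone. -/
theorem exists_residue (hirr : IsIrreducibleK T K)
    {k : Matrix (Fin d × Fin dB) (Fin d × Fin dB) ℂ}
    {φ ψ : fixedSubalgebra α →ₗ⁅ℂ⁆ Matrix (Fin d) (Fin d) ℂ} (hφ : Function.Injective φ)
    (h : ∀ v ∈ T, ∑ a, Λ₁ (φ (e a)) * Λ₂₃ (λL (φ (e a)) * K v - K v * λL (ψ (e a)))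
      + (Λ₁₃ k * Λ₂₃ (K v) - Λ₂₃ (K v) * Λ₁₃ k) = 0) :
    ∃ (ρB : fixedSubalgebra α →ₗ⁅ℂ⁆ Matrix (Fin dB) (Fin dB) ℂ) (E : Matrix (Fin d) (Fin d) ℂ),
      (∀ v ∈ T, ∀ x,
        λL (φ x) * K v - K v * λL (ψ x) + (λR (ρB x) * K v - K v * λR (ρB x)) = 0) ∧
      k = λL E + ∑ a, φ (e a) ⊗ₖ ρB (e a) := by
  obtain ⟨τ, hτ⟩ := exists_boundary_map (T := T) (K := K) e
    (φ : fixedSubalgebra α →ₗ[ℂ] Matrix (Fin d) (Fin d) ℂ) ψ hφ (fun i j => block k i j)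
    fun v hv i j => slice_equation (h v hv) i j
  obtain ⟨ρB, hρB⟩ := exists_boundary_hom hirr φ ψ τ hτ
  obtain ⟨E, hE⟩ := hirr.exists_eq_leftHom (Q := k - ∑ a, φ (e a) ⊗ₖ ρB (e a)) fun v hv => by
    have hterm : ∀ a, Λ₁ (φ (e a)) * Λ₂₃ (λL (φ (e a)) * K v - K v * λL (ψ (e a))) =
        Λ₂₃ (K v) * (Λ₁ (φ (e a)) * Λ₃ (ρB (e a)))
          - Λ₁ (φ (e a)) * Λ₃ (ρB (e a)) * Λ₂₃ (K v) := fun a => by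
      rw [eq_neg_of_add_eq_zero_left (hρB v hv (e a)), ← mul_assoc (Λ₂₃ (K v)),
        ← (leg1_commute_leg23Hom (φ (e a)) (K v)).eq, ← leg23Hom_rightHom, map_neg, map_sub,
        map_mul, map_mul]
      noncomm_ring
    have h1 := h v hv
    simp only [hterm, Finset.sum_sub_distrib, ← Finset.mul_sum, ← Finset.sum_mul] at h1
    rw [commute_iff_eq, ← sub_eq_zero, map_sub, map_sum]
    simp only [leg13Hom_kronecker]
    rw [← h1]
    noncomm_ring
  exact ⟨ρB, E, hρB, by rw [← hE]; abel⟩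

/-- The 1/u coefficient of the 𝔥-symmetry says that k₁κ⁻¹ is 𝔥-invariant; so is the Casimir tensor,
hence also E. -/
theorem residue_commute [Nonempty (Fin dB)] (hT : T ∈ cobounded ℂ) (hκ : IsUnit κ)
    (hexp : HasExpansion (cobounded ℂ) (fun u => u⁻¹) K (λL κ) k₁)
    {φ ψ : fixedSubalgebra α →ₗ⁅ℂ⁆ Matrix (Fin d) (Fin d) ℂ}
    (hψ : ∀ x, κ * ψ x * κ⁻¹ = φ x)
    (he : IsOrthonormalBasis (killingOn (fixedSubalgebra α)) e)
    {ρB : fixedSubalgebra α →ₗ⁅ℂ⁆ Matrix (Fin dB) (Fin dB) ℂ} {E : Matrix (Fin d) (Fin d) ℂ}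
    (h : ∀ v ∈ T, ∀ x,
      λL (φ x) * K v - K v * λL (ψ x) + (λR (ρB x) * K v - K v * λR (ρB x)) = 0)
    (hk : k₁ * λL κ⁻¹ = λL E + (2 : ℂ) • ∑ a, φ (e a) ⊗ₖ ρB (e a)) (x : fixedSubalgebra α) :
    Commute E (φ x) := by
  have hκκ' : κ⁻¹ * κ = 1 :=
    Matrix.nonsing_inv_mul κ ((Matrix.isUnit_iff_isUnit_det κ).mp hκ)
  have hLR : ∀ X Y, Commute (λL X) (λR Y) := fun X Y =>
    (leftHom_mul_rightHom X Y).trans (rightHom_mul_leftHom X Y).symm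
  have h1 := (hexp.linear_relation hT
    (LinearMap.mulLeft ℂ (λL (φ x)) - LinearMap.mulRight ℂ (λL (ψ x))
      + (LinearMap.mulLeft ℂ (λR (ρB x)) - LinearMap.mulRight ℂ (λR (ρB x))))
    fun v hv => by simpa using h v hv x).2
  simp only [LinearMap.add_apply, LinearMap.sub_apply, LinearMap.mulLeft_apply,
    LinearMap.mulRight_apply] at h1
  have hψ' : ψ x * κ⁻¹ = κ⁻¹ * φ x := by
    rw [← hψ, mul_assoc κ, ← mul_assoc κ⁻¹, hκκ', one_mul]
  have h2 : Commute (λL (φ x) + λR (ρB x)) (k₁ * λL κ⁻¹) := by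
    rw [commute_iff_eq, ← sub_eq_zero]
    have h3 := congrArg (· * λL κ⁻¹) h1
    simp only [zero_mul] at h3
    rw [← h3]
    have e1 : k₁ * λL κ⁻¹ * λL (φ x) = k₁ * λL (ψ x) * λL κ⁻¹ := by
      rw [mul_assoc, mul_assoc, ← map_mul, ← map_mul, hψ']
    have e2 : k₁ * λL κ⁻¹ * λR (ρB x) = k₁ * λR (ρB x) * λL κ⁻¹ := by
      rw [mul_assoc, mul_assoc, (hLR _ _).eq]
    rw [mul_add, e1, e2]
    noncomm_ring
  have h4 := he.commute_add (killingOn_lie _) φ ρB (λL) (λR) hLR x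
  simp only [leftHom_mul_rightHom] at h4
  have h5 : Commute (λL (φ x) + λR (ρB x)) (λL E) := by
    have h6 := h2.sub_right (h4.smul_right (2 : ℂ))
    rwa [hk, add_sub_cancel_right] at h6
  have h7 : Commute (λL (φ x)) (λL E) := by
    have h8 := h5.sub_left (hLR E (ρB x)).symm
    rwa [add_sub_cancel_right] at h8
  refine leftHom_injective (m := Fin dB) ?_
  rw [map_mul, map_mul, h7.eq]

theorem kronecker_relation [Nonempty (Fin dB)] {ι : Type*} [Fintype ι]
    (x : ι → Matrix (Fin d) (Fin d) ℂ) (E c : Matrix (Fin d) (Fin d) ℂ)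
    (h : (∑ a, Λ₁ (x a) * Λ₂ (x a)) * (Λ₁ E + Λ₂ E - (1 / 2 : ℂ) • (Λ₁ c + Λ₂ c)) -
      (Λ₁ E + Λ₂ E - (1 / 2 : ℂ) • (Λ₁ c + Λ₂ c)) * (∑ a, Λ₁ (x a) * Λ₂ (x a)) = 0) :
    ∑ a, ((x a * (E - (1 / 2 : ℂ) • c) - (E - (1 / 2 : ℂ) • c) * x a) ⊗ₖ x a
      + x a ⊗ₖ (x a * (E - (1 / 2 : ℂ) • c) - (E - (1 / 2 : ℂ) • c) * x a)) = 0 := by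
  set F := E - (1 / 2 : ℂ) • c
  have hF : Λ₁ E + Λ₂ E - (1 / 2 : ℂ) • (Λ₁ c + Λ₂ c) = Λ₁ F + Λ₂ F := by
    simp only [F, map_sub, map_smul, smul_add]
    abel
  rw [hF] at h
  refine leg12Hom_injective (n := Fin dB) ?_
  rw [map_zero, ← h, map_sum, Finset.sum_mul, Finset.mul_sum, ← Finset.sum_sub_distrib]
  refine Finset.sum_congr rfl fun a _ => ?_
  rw [map_add, leg12Hom_kronecker, leg12Hom_kronecker, map_sub, map_sub, map_mul, map_mul, map_mul,
    map_mul]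
  have c1 := (leg1_commute_leg2 (n := Fin dB) F (x a)).eq
  have c2 := (leg1_commute_leg2 (n := Fin dB) (x a) F).eq
  have e1 : Λ₁ (x a) * Λ₂ (x a) * Λ₁ F = Λ₁ (x a) * Λ₁ F * Λ₂ (x a) := by
    rw [mul_assoc, ← c1, mul_assoc]
  have e2 : Λ₂ F * (Λ₁ (x a) * Λ₂ (x a)) = Λ₁ (x a) * (Λ₂ F * Λ₂ (x a)) := by
    rw [← mul_assoc, ← c2, mul_assoc]
  rw [mul_add, add_mul, e1, e2]
  noncomm_ring

/-- Adding a character to a representation on the boundary space. -/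
theorem exists_character_shift {𝔥 : Type*} [LieRing 𝔥] [LieAlgebra ℂ 𝔥]
    (ρB : 𝔥 →ₗ⁅ℂ⁆ Matrix (Fin dB) (Fin dB) ℂ) (χ : 𝔥 →ₗ[ℂ] ℂ) (hχ : ∀ x y : 𝔥, χ ⁅x, y⁆ = 0) :
    ∃ ρB' : 𝔥 →ₗ⁅ℂ⁆ Matrix (Fin dB) (Fin dB) ℂ, ∀ x, ρB' x = ρB x + χ x • 1 := by
  let σ : 𝔥 →ₗ[ℂ] Matrix (Fin dB) (Fin dB) ℂ :=
    (ρB : 𝔥 →ₗ[ℂ] Matrix (Fin dB) (Fin dB) ℂ) + LinearMap.toSpanSingleton ℂ _ 1 ∘ₗ χ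
  have hσ : ∀ x, σ x = ρB x + χ x • 1 := fun _ => rfl
  have hlie : ∀ x y, σ ⁅x, y⁆ = ⁅σ x, σ y⁆ := fun x y => by
    rw [hσ, hσ, hσ, hχ, LieHom.map_lie, Ring.lie_def, Ring.lie_def]
    simp only [add_mul, mul_add, smul_mul_assoc, mul_smul_comm, mul_one, one_mul]
    module
  exact ⟨{ σ with map_lie' := fun {x y} => hlie x y }, hσ⟩

theorem exists_residue_form [Nonempty (Fin dB)]
    {𝔥₀ : LieSubalgebra ℂ 𝔤} (hρ : Function.Injective (ρ 0)) (hR : IsQuasiClassicalR ρ S R)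
    (hK : IsKMatrix ρ S R 𝔥₀ T K) (hirr : IsIrreducibleK T K) (hκ : IsUnit κ)
    (hexp : HasExpansion (cobounded ℂ) (fun u => u⁻¹) K (λL κ) k₁)
    (hα : ∀ x, κ * ρ 1 x * κ⁻¹ = ρ 0 (α x))
    (he : IsOrthonormalBasis (killingOn (fixedSubalgebra α)) e)
    (hb : IsOrthonormalBasis (killingForm ℂ 𝔤) b) (hbe : ∀ a, b (Sum.inl a) = e a)
    (hbα : ∀ a, α (b (Sum.inr a)) = -b (Sum.inr a)) :
    ∃ (ρB : fixedSubalgebra α →ₗ⁅ℂ⁆ Matrix (Fin dB) (Fin dB) ℂ) (E : Matrix (Fin d) (Fin d) ℂ),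
      (∀ x : fixedSubalgebra α, Commute E (ρ 0 x)) ∧
      k₁ * λL κ⁻¹ = λL E + (2 : ℂ) • ∑ a, ρ 0 (e a) ⊗ₖ ρB (e a) := by
  obtain ⟨ρB, E, hρB, hk⟩ := exists_residue (φ := (ρ 0).comp (fixedSubalgebra α).incl)
    (ψ := (ρ 1).comp (fixedSubalgebra α).incl) (e := e) hirr
    (fun x y hxy => Subtype.ext (hρ hxy))
    fun v hv => hK.fixed_equation hR hκ hexp hα hb hbe hbα hv
  have hk' : k₁ * λL κ⁻¹ = λL ((2 : ℂ) • E) + (2 : ℂ) • ∑ a, ρ 0 (e a) ⊗ₖ ρB (e a) := by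
    have h2 := congrArg (fun Q => (2 : ℂ) • Q) hk
    simp only [smul_smul, smul_add] at h2
    rw [map_smul]
    norm_num at h2
    exact h2
  refine ⟨ρB, (2 : ℂ) • E, ?_, hk'⟩
  exact residue_commute (ψ := (ρ 1).comp (fixedSubalgebra α).incl)
    (φ := (ρ 0).comp (fixedSubalgebra α).incl) hK.regular hκ hexp
    (fun x => (hα x).trans (congrArg (ρ 0) x.2)) he hρB hk'

theorem IsOrthonormalBasis.commute_casimir {𝔨 ι : Type*} [LieRing 𝔨] [LieAlgebra ℂ 𝔨]
    [Fintype ι] [DecidableEq ι] {B : LinearMap.BilinForm ℂ 𝔨} {e : Module.Basis ι ℂ 𝔨}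
    (h : IsOrthonormalBasis B e) (hB : ∀ x y z : 𝔨, B ⁅x, y⁆ z = -B y ⁅x, z⁆)
    (φ : 𝔨 →ₗ⁅ℂ⁆ Matrix (Fin d) (Fin d) ℂ) (x : 𝔨) :
    Commute (φ x) (∑ a, φ (e a) * φ (e a)) := by
  have hφ : ∀ y, φ x * φ y - φ y * φ x = φ ⁅x, y⁆ := fun y => by
    rw [LieHom.map_lie, Ring.lie_def]
  exact h.commute_sum_mul hB (φ : 𝔨 →ₗ[ℂ] Matrix (Fin d) (Fin d) ℂ)
    (φ : 𝔨 →ₗ[ℂ] Matrix (Fin d) (Fin d) ℂ) x hφ hφ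

/-- A term Σ t_a x_a may be moved between the first leg and the tensor term; the overall factor 2
there explains the −½. -/
theorem residue_shift {ι : Type*} [Fintype ι] (x : ι → Matrix (Fin d) (Fin d) ℂ)
    (y : ι → Matrix (Fin dB) (Fin dB) ℂ) (t : ι → ℂ) (E c : Matrix (Fin d) (Fin d) ℂ) :
    λL E + (2 : ℂ) • ∑ a, x a ⊗ₖ y a =
      (1 / 2 : ℂ) • c ⊗ₖ 1 + (E - (1 / 2 : ℂ) • c + ∑ a, t a • x a) ⊗ₖ 1
        + (2 : ℂ) • ∑ a, x a ⊗ₖ (y a + (-(1 / 2 : ℂ) * t a) • 1) := by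
  simp only [← leftHom_apply, Matrix.kronecker_add, Matrix.kronecker_smul, map_add, map_sub,
    map_smul, map_sum, Finset.sum_add_distrib, smul_add, Finset.smul_sum, smul_smul]
  have : ∀ a, (2 : ℂ) * (-(1 / 2) * t a) = -t a := fun a => by ring
  simp only [this, neg_smul, Finset.sum_neg_distrib]
  abel

theorem exists_final_form [Nonempty (Fin dB)] [LieAlgebra.IsKilling ℂ 𝔤]
    {𝔥₀ : LieSubalgebra ℂ 𝔤} (hρ : Function.Injective (ρ 0)) (hR : IsQuasiClassicalR ρ S R)
    (hK : IsKMatrix ρ S R 𝔥₀ T K) (hirr : IsIrreducibleK T K) (hκ : IsUnit κ)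
    (hexp : HasExpansion (cobounded ℂ) (fun u => u⁻¹) K (λL κ) k₁)
    (hα : IsAssociatedInvolution ρ κ α) :
    ∃ (D : Matrix (Fin d) (Fin d) ℂ)
      (ρB : fixedSubalgebra α →ₗ⁅ℂ⁆ Matrix (Fin dB) (Fin dB) ℂ),
      (∀ X, D * ρ 0 X = ρ 0 X * D) ∧
      k₁ = ((1 / 2 : ℂ) • casimir (killingOn (fixedSubalgebra α))
          ((ρ 0).comp (fixedSubalgebra α).incl : _ →ₗ[ℂ] _) ⊗ₖ 1 + D ⊗ₖ 1
        + (2 : ℂ) • casimirTensor (killingOn (fixedSubalgebra α))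
          ((ρ 0).comp (fixedSubalgebra α).incl : _ →ₗ[ℂ] _) (ρB : _ →ₗ[ℂ] _)) * (κ ⊗ₖ 1) := by
  obtain ⟨hinv, hα⟩ := hα
  obtain ⟨p, q, e, b, he, hb, hbe, hbα⟩ := exists_adapted_basis α hinv
  obtain ⟨ρB, E, hE, hk⟩ := exists_residue_form hρ hR hK hirr hκ hexp hα he hb hbe hbα
  have hc := he.commute_casimir (killingOn_lie _) ((ρ 0).comp (fixedSubalgebra α).incl)
  have hN := kronecker_relation _ _ _
    (hK.second_order hR hκ hexp hα he hb hbe hbα ρB (fun a => hE (e a)) rfl hk)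
  obtain ⟨z, hz, hzc, hD⟩ := exists_central_shift (α := α) (ρ 0) hρ
    (fun a => by rw [hbe]; exact (e a).2) hbα _
    (fun a => by
      rw [hbe]
      exact (hE (e a)).symm.sub_right ((hc (e a)).smul_right _)) hN
  obtain ⟨ρB', hρB'⟩ := exists_character_shift ρB
    -- B(·, z) vanishes on brackets because B is invariant and z is central in 𝔥.
    (-(1 / 2 : ℂ) • (killingOn (fixedSubalgebra α)).flip ⟨z, hz⟩) fun x y => by
      have h0 : ⁅x, (⟨z, hz⟩ : fixedSubalgebra α)⁆ = 0 := by
        rw [← lie_skew, neg_eq_zero]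
        exact Subtype.ext (hzc x x.2)
      simp [killingOn_lie, h0]
  refine ⟨_, ρB', hD, ?_⟩
  have hzsum : ρ 0 z = ∑ a, killingOn (fixedSubalgebra α) (e a) ⟨z, hz⟩ • ρ 0 (e a) := by
    have := congrArg ((ρ 0).comp (fixedSubalgebra α).incl) (he.sum_smul ⟨z, hz⟩)
    rw [map_sum] at this
    simp only [map_smul] at this
    exact this.symm
  have hcancel : k₁ = k₁ * λL κ⁻¹ * λL κ := by
    rw [mul_assoc, ← map_mul,
      Matrix.nonsing_inv_mul κ ((Matrix.isUnit_iff_isUnit_det κ).mp hκ), map_one, mul_one]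
  have hfinal := residue_shift (fun a => ρ 0 (e a)) (fun a => ρB (e a))
    (fun a => killingOn (fixedSubalgebra α) (e a) ⟨z, hz⟩) E (∑ a, ρ 0 (e a) * ρ 0 (e a))
  have hB : ∀ a, ρB (e a) + (-(1 / 2 : ℂ) * killingOn (fixedSubalgebra α) (e a) ⟨z, hz⟩) • 1 =
      ρB' (e a) := fun a => (hρB' (e a)).symm
  simp only [hB, ← hzsum] at hfinal
  rw [hcancel, hk, hfinal, he.casimir_eq, he.casimirTensor_eq]
  rfl

end Residue

end KMat

end

theorem mainTheorem6 {𝔤 : Type*} [LieRing 𝔤] [LieAlgebra ℂ 𝔤] [FiniteDimensional ℂ 𝔤]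
    [LieAlgebra.IsSimple ℂ 𝔤] {d dB : ℕ}
    (ρ : Fin 2 → 𝔤 →ₗ⁅ℂ⁆ Matrix (Fin d) (Fin d) ℂ)
    (hρ : ∀ i, Function.Injective (ρ i))
    (S : Set ℂ) (R : Fin 2 → Fin 2 → ℂ → Matrix (Fin d × Fin d) (Fin d × Fin d) ℂ)
    (hR : KMat.IsQuasiClassicalR ρ S R)
    (𝔥₀ : LieSubalgebra ℂ 𝔤)
    (T : Set ℂ) (K : ℂ → Matrix (Fin d × Fin dB) (Fin d × Fin dB) ℂ)
    (hK : KMat.IsKMatrix ρ S R 𝔥₀ T K)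
    (hirr : KMat.IsIrreducibleK T K)
    (κ' : Matrix (Fin d × Fin dB) (Fin d × Fin dB) ℂ)
    (hqc : KMat.IsQuasiClassicalK K κ')
    (hexp : ∃ k₁, KMat.IsBigOInv (fun u => K u - (κ' + u⁻¹ • k₁)) 2) :
    ∃ κ : Matrix (Fin d) (Fin d) ℂ, IsUnit κ ∧ κ' = κ ⊗ₖ 1 ∧
      (∃! α : 𝔤 →ₗ⁅ℂ⁆ 𝔤, KMat.IsAssociatedInvolution ρ κ α) ∧
      ∀ α : 𝔤 →ₗ⁅ℂ⁆ 𝔤, KMat.IsAssociatedInvolution ρ κ α →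
        ∃ (D : Matrix (Fin d) (Fin d) ℂ)
          (ρB : KMat.fixedSubalgebra α →ₗ⁅ℂ⁆ Matrix (Fin dB) (Fin dB) ℂ),
          (∀ X, D * ρ 0 X = ρ 0 X * D) ∧
          KMat.IsBigOInv (fun u => K u - (κ ⊗ₖ 1 + u⁻¹ •
            (((1 / 2 : ℂ) • KMat.casimir (KMat.killingOn (KMat.fixedSubalgebra α))
                  ((ρ 0).comp (KMat.fixedSubalgebra α).incl : _ →ₗ[ℂ] _) ⊗ₖ 1
                + D ⊗ₖ 1
                + (2 : ℂ) • KMat.casimirTensor (KMat.killingOn (KMat.fixedSubalgebra α))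
                  ((ρ 0).comp (KMat.fixedSubalgebra α).incl : _ →ₗ[ℂ] _)
                  (ρB : _ →ₗ[ℂ] _))
              * (κ ⊗ₖ 1)))) 2 := by
  have : Nonempty (Fin dB) := ⟨⟨0, hirr.1⟩⟩
  obtain ⟨k₁, hk₁⟩ := hexp
  have hexp := KMat.hasExpansion_of_isBigOInv hk₁
  obtain ⟨b, hb⟩ := KMat.exists_isOrthonormalBasis (LieModule.traceForm_isSymm ℂ 𝔤 𝔤)
    (LieAlgebra.IsKilling.killingForm_nondegenerate ℂ 𝔤)
  obtain ⟨κ, rfl⟩ := hirr.exists_eq_leftHom fun v hv => (hK.first_order hR hb hexp hv).1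
  have hκ : IsUnit κ := KMat.isUnit_of_isUnit_leftHom hqc.isUnit
  refine ⟨κ, hκ, rfl, ?_, fun α hα => ?_⟩
  -- If ρ 0 + σ and ρ 0 − σ both kill x, then 2ρ 0(x) = 0, and faithfulness gives x = 0.
  · have hsplit := KMat.isCompl_ker_of_sum_eq_zero (LieModule.traceForm_isSymm ℂ 𝔤 𝔤) hb
      ((ρ 0 : 𝔤 →ₗ[ℂ] Matrix (Fin d) (Fin d) ℂ) +
        (KMat.conjHom κ hκ (ρ 1) : 𝔤 →ₗ[ℂ] Matrix (Fin d) (Fin d) ℂ))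
      ((ρ 0 : 𝔤 →ₗ[ℂ] Matrix (Fin d) (Fin d) ℂ) -
        (KMat.conjHom κ hκ (ρ 1) : 𝔤 →ₗ[ℂ] Matrix (Fin d) (Fin d) ℂ))
      (KMat.classical_limit hK.regular hκ hexp fun v hv =>
        hK.classical_equation hR hb hκ hexp hv)
      fun x h1 h2 => by
        have h3 : (2 : ℂ) • ρ 0 x = 0 := by
          have h4 := congrArg₂ (· + ·) h1 h2
          simp only [LinearMap.add_apply, LinearMap.sub_apply, add_add_sub_cancel, add_zero] at h4
          rw [two_smul]
          exact h4
        exact hρ 0 (((smul_eq_zero.mp h3).resolve_left two_ne_zero).trans (map_zero _).symm)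
    obtain ⟨α, hinv, hα⟩ := KMat.exists_involution (ρ 0) (hρ 0) (KMat.conjHom κ hκ (ρ 1)) hsplit
    refine ⟨α, ⟨hinv, fun X => by rw [hα, KMat.conjHom_apply]⟩, fun α' hα' => ?_⟩
    refine LieHom.ext fun X => hρ 0 ?_
    rw [hα, KMat.conjHom_apply, hα'.2]
  · obtain ⟨D, ρB, hD, hk⟩ := KMat.exists_final_form (hρ 0) hR hK hirr hκ hexp hα
    refine ⟨D, ρB, hD, ?_⟩
    rw [← hk]
    exact hk₁
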